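/- **Definitions.** A (finite) digraph $D$ consists of a finite vertex set $V$ and an arrow set contained in $V\times V$ (loops are allowed, multiple arrows are not). Let $n=|V|$. Write $E\subseteq D$ if $E$ is a spanning subdigraph of $D$, that is, $E$ has vertex set $V$ and every arrow of $E$ is an arrow of $D$. A path cover (respectively cycle cover) of $D$ is an $E\subseteq D$ that is a disjoint union of directed paths (respectively directed cycles) such that every vertex lies in exactly one of them; an isolated vertex counts as a path, and a loop as a cycle. The type $t(E)$ of a digraph $E$ is the partition of the number of its vertices whose parts are the sizes of the (weakly) connected components of $E$, and $\ell(\lambda)$ is the number of parts of a partition $\lambda$. Let $e_\lambda$, $h_\lambda$, $p_\lambda$ be the elementary, complete homogeneous and power sum symmetric functions in infinitely many variables, with integer coefficients. The cycle symmetric function of $D$ is $$Z_D=\sum_{F} p_{t(F)},$$ where the sum is over all cycle covers $F$ of $D$. If $E$ is a path cover of $D$, then $D/E$ is the digraph whose vertices are the components of $E$ (which are paths), with an arrow from $v$ to $w$ if and only if $D$ has an arrow from the end of the path $v$ to the beginning of the path $w$. The determinant of the adjacency matrix of $D/E$ is denoted $\det(D/E)$. **Theorem.** Let $D$ be a digraph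 with $n$ vertices, and expand $Z_D$ in the families $(e_\lambda)_{\lambda\vdash n}$ and $(h_\lambda)_{\lambda\vdash n}$. 1. For every partition $\lambda$ of $n$, the coefficient of $(-1)^{n-\ell(\lambda)}e_\lambda$ in $Z_D$ is the number of ordered pairs $(E,F)$, where $E$ is a path cover of $D$ of type $\lambda$ and $F$ is a cycle cover of $D/E$. 2. For every partition $\lambda$ of $n$, the coefficient of $h_\lambda$ in $Z_D$ is $$\sum_{E}\det(D/E),$$ where the sum is over all path covers $E$ of $D$ of type $\lambda$. In both parts, the numbers described are the only integers that can serve as coefficients in an expansion of $Z_D$ as an integer linear combination of the family, so the coefficients are well defined. -/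

import Mathlib

namespace Digraph

variable {V : Type*}

/-- The (weakly) connected components of a digraph `E`. -/
def Component (E : Digraph V) : Type _ :=
  E.toSimpleGraphInclusive.ConnectedComponent

/-- The set of vertices of a connected component. -/
def Component.verts {E : Digraph V} (C : E.Component) : Set V :=
  SimpleGraph.ConnectedComponent.supp C

/-- The connected component of `E` that contains the vertex `v`. -/
def componentOf (E : Digraph V) (v : V) : E.Component :=
  E.toSimpleGraphInclusive.connectedComponentMk v

theorem mem_verts_iff {E : Digraph V} {C : E.Component} {v : V} :
    v ∈ C.verts ↔ E.componentOf v = C :=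
  Iff.rfl

theorem componentOf_surjective (E : Digraph V) : Function.Surjective E.componentOf :=
  Quot.mk_surjective

noncomputable instance (E : Digraph V) : DecidableEq E.Component := Classical.decEq _

noncomputable instance [Finite V] (E : Digraph V) : Fintype E.Component :=
  haveI := Finite.of_surjective _ E.componentOf_surjective
  Fintype.ofFinite _

/-- The restriction of `E` to the vertex set `S` is a directed path: its vertices can be listed
without repetition as `f 0, …, f k` so that its arrows are exactly the `(f i, f (i + 1))` with
`i < k`. An isolated vertex is a path. -/
def IsPathOn (E : Digraph V) (S : Set V) : Prop :=
  ∃ (k : ℕ) (f : Fin (k + 1) → V), Function.Injective f ∧ Set.range f = S ∧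
    ∀ i j : Fin (k + 1), E.Adj (f i) (f j) ↔ (i : ℕ) + 1 = (j : ℕ)

/-- The restriction of `E` to the vertex set `S` is a directed cycle: its vertices can be listed
without repetition as `f 0, …, f k` so that its arrows are exactly the `(f i, f (i + 1))`, where
`i + 1` is taken modulo `k + 1`. A single vertex with a loop is a cycle. -/
def IsCycleOn (E : Digraph V) (S : Set V) : Prop :=
  ∃ (k : ℕ) (f : Fin (k + 1) → V), Function.Injective f ∧ Set.range f = S ∧
    ∀ i j : Fin (k + 1), E.Adj (f i) (f j) ↔ j = i + 1

/-- `E` is a path cover of `D`: a spanning subdigraph that is a disjoint union of paths. -/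
def IsPathCover (D E : Digraph V) : Prop :=
  E ≤ D ∧ ∀ C : E.Component, E.IsPathOn C.verts

/-- `F` is a cycle cover of `D`: a spanning subdigraph that is a disjoint union of cycles. -/
def IsCycleCover (D F : Digraph V) : Prop :=
  F ≤ D ∧ ∀ C : F.Component, F.IsCycleOn C.verts

/-- The type of a digraph: the partition of the number of vertices whose parts are the sizes
of the connected components. -/
noncomputable def type [Fintype V] (E : Digraph V) : (Fintype.card V).Partition where
  parts := (Finset.univ : Finset E.Component).val.map fun C => C.verts.ncard
  parts_pos := by
    intro i hi
    obtain ⟨C, -, rfl⟩ := Multiset.mem_map.1 hi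
    obtain ⟨v, hv⟩ := E.componentOf_surjective C
    exact (Set.ncard_pos (Set.toFinite _)).2 ⟨v, mem_verts_iff.2 hv⟩
  parts_sum := by
    classical
    change ∑ C : E.Component, C.verts.ncard = _
    rw [← Finset.card_univ, Finset.card_eq_sum_card_fiberwise
      (f := E.componentOf) (t := Finset.univ) (fun _ _ => Finset.mem_univ _)]
    refine Finset.sum_congr rfl fun C _ => ?_
    rw [← Set.ncard_coe_finset]
    congr 1
    ext v
    simp [mem_verts_iff]

/-- The finite set of cycle covers of `D`. -/
noncomputable def cycleCovers [Finite V] (D : Digraph V) : Finset (Digraph V) :=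
  haveI : Finite (Digraph V) := Finite.of_injective _ adj_injective
  (Set.toFinite {F : Digraph V | D.IsCycleCover F}).toFinset

/-- The finite set of path covers of `D` of type `μ`. -/
noncomputable def pathCovers [Fintype V] (D : Digraph V) (μ : (Fintype.card V).Partition) :
    Finset (Digraph V) :=
  haveI : Finite (Digraph V) := Finite.of_injective _ adj_injective
  (Set.toFinite {E : Digraph V | D.IsPathCover E ∧ E.type = μ}).toFinset

/-- The contraction `D/E`, for a path cover `E` of `D`. Its vertices are the components of `E`,
which are paths; there is an arrow from `P` to `Q` if and only if `D` has an arrow from the end of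
`P` (the vertex of `P` from which no arrow of `E` points) to the beginning of `Q` (the vertex of
`Q` to which no arrow of `E` points). -/
def contract (D E : Digraph V) : Digraph E.Component where
  Adj P Q := ∃ v ∈ P.verts, ∃ w ∈ Q.verts,
    (∀ u, ¬ E.Adj v u) ∧ (∀ u, ¬ E.Adj u w) ∧ D.Adj v w

open Classical in
/-- The adjacency matrix of a digraph. -/
noncomputable def adjacencyMatrix (D : Digraph V) : Matrix V V ℤ :=
  Matrix.of fun v w => if D.Adj v w then 1 else 0

end Digraph

/-! Symmetric functions in the variables `x₀, x₁, x₂, …`, as formal power series over `ℤ`. -/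

namespace SymmFun

open Classical in
/-- The elementary symmetric function `e_k`: the sum of all squarefree monomials of degree `k`. -/
noncomputable def elem (k : ℕ) : MvPowerSeries ℕ ℤ :=
  fun m => if m.degree = k ∧ ∀ i, m i ≤ 1 then 1 else 0

open Classical in
/-- The complete homogeneous symmetric function `h_k`: the sum of all monomials of degree `k`. -/
noncomputable def homog (k : ℕ) : MvPowerSeries ℕ ℤ :=
  fun m => if m.degree = k then 1 else 0

open Classical in
/-- The power sum symmetric function `p_k`, for `k ≥ 1`: the sum of the monomials `x_i ^ k`. -/
noncomputable def power (k : ℕ) : MvPowerSeries ℕ ℤ :=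
  fun m => if ∃ i, m = Finsupp.single i k then 1 else 0

/-- `e_μ`, the product of the `e_k` over the parts `k` of `μ`. -/
noncomputable def elemPart {n : ℕ} (μ : n.Partition) : MvPowerSeries ℕ ℤ :=
  (μ.parts.map elem).prod

/-- `h_μ`, the product of the `h_k` over the parts `k` of `μ`. -/
noncomputable def homogPart {n : ℕ} (μ : n.Partition) : MvPowerSeries ℕ ℤ :=
  (μ.parts.map homog).prod

/-- `p_μ`, the product of the `p_k` over the parts `k` of `μ`. -/
noncomputable def powerPart {n : ℕ} (μ : n.Partition) : MvPowerSeries ℕ ℤ :=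
  (μ.parts.map power).prod

end SymmFun

/-- The cycle symmetric function `Z_D`: the sum of `p_{t(F)}` over the cycle covers `F` of `D`. -/
noncomputable def Digraph.cycleSymm {V : Type*} [Fintype V] (D : Digraph V) :
    MvPowerSeries ℕ ℤ :=
  ∑ F ∈ D.cycleCovers, SymmFun.powerPart F.type

/-! Cycle covers of `D` are the permutations `σ` of `V` with every arrow `v → σ v` in `D`. For a
digraph whose components are paths, `e_{t(E)}` is the sum of the monomials of the colourings `κ` of
`V` that strictly increase along the arrows of `E`, and `h_{t(E)}` the same for weakly increasing
ones; `p_{t(F)}` is the sum over colourings constant along the arrows of `F`.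

The core is the case of a single permutation: `p_{t(σ)}` is the sum over path covers `E` of `σ` of
`(-1)^(n-ℓ(E)) e_{t(E)}` (`powerPart_eq_sum_elemPart`), and also of `(-1)^(ℓ(E)+c(σ)) h_{t(E)}`,
with `c(σ)` the number of cycles (`powerPart_eq_sum_homogPart`). Both are checked one colouring at a
time: a colouring that is not constant on the cycles of `σ` cancels by a sign-reversing argument
(`sum_isPaths_cut_respects_lt`, `sum_isPaths_cut_respects_le`).

Summing over `σ` and exchanging the sums, each path cover `E` of `D` is weighted by the permutations
in `D` that contain `E`. Contracting paths matches these with the permutations `τ` in `D/E` and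
preserves the number of cycles (`sum_perms_contract`, `card_component_contractPerm`). Unsigned, this
counts the cycle covers of `D/E`; with the sign `(-1)^(ℓ(E)+c(σ)) = sign τ` it is `det(D/E)`.

Uniqueness of the coefficients is linear independence of the `e_λ` and of the `h_λ`. The first
follows from the fundamental theorem of symmetric polynomials, the second from the relation between
the `e_k` and the `h_k`. -/

namespace SymmFun

/-! ### Truncation to finitely many variables -/

open MvPowerSeries

/-- Setting the variables `x_N, x_{N+1}, …` to zero. -/
noncomputable def trunc (N : ℕ) : MvPowerSeries ℕ ℤ →+* MvPowerSeries (Fin N) ℤ :=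
  (MvPowerSeries.killCompl (R := ℤ) Fin.valEmbedding).toRingHom

theorem coeff_trunc {N : ℕ} (f : MvPowerSeries ℕ ℤ) (m : Fin N →₀ ℕ) :
    coeff m (trunc N f) = f (m.embDomain Fin.valEmbedding) :=
  rfl

/-- A monomial involves finitely many variables, so it survives in every large enough truncation. -/
theorem eq_of_trunc_eq {f g : MvPowerSeries ℕ ℤ} (h : ∀ N, trunc N f = trunc N g) : f = g := by
  ext m
  obtain ⟨m', hm⟩ : m ∈ Set.range (Finsupp.embDomain
      (Fin.valEmbedding : Fin (m.support.sup id + 1) ↪ ℕ)) := by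
    rw [Finsupp.mem_range_embDomain_iff]
    intro i hi
    exact ⟨⟨i, Nat.lt_succ_of_le (Finset.le_sup (f := id) hi)⟩, rfl⟩
  rw [← hm]
  exact congrArg (coeff m') (h _)

theorem degree_embDomain {α β : Type*} (e : α ↪ β) (m : α →₀ ℕ) :
    (m.embDomain e).degree = m.degree := by
  rw [Finsupp.embDomain_eq_mapDomain, Finsupp.degree_mapDomain]

theorem embDomain_le_one_iff {α β : Type*} (e : α ↪ β) (m : α →₀ ℕ) :
    (∀ i, m.embDomain e i ≤ 1) ↔ ∀ i, m i ≤ 1 := by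
  refine ⟨fun h i => by simpa using h (e i), fun h i => ?_⟩
  by_cases hi : i ∈ Set.range e
  · obtain ⟨j, rfl⟩ := hi
    simpa using h j
  · rw [Finsupp.embDomain_of_notMem_range _ _ _ hi]
    exact zero_le_one

open Classical in
theorem coeff_trunc_homog {N k : ℕ} (m : Fin N →₀ ℕ) :
    coeff m (trunc N (homog k)) = if m.degree = k then 1 else 0 := by
  rw [coeff_trunc, homog, degree_embDomain]

open Classical in
theorem coeff_trunc_elem {N k : ℕ} (m : Fin N →₀ ℕ) :
    coeff m (trunc N (elem k)) = if m.degree = k ∧ ∀ i, m i ≤ 1 then 1 else 0 := by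
  simp only [coeff_trunc, elem, degree_embDomain, embDomain_le_one_iff]

/-- The case `k = 0` is a genuine exception: the `N` monomials `X i ^ 0` coincide. -/
theorem trunc_power {N k : ℕ} (hk : k ≠ 0) : trunc N (power k) = ∑ i, X i ^ k := by
  classical
  ext m
  simp only [coeff_trunc, power, map_sum, coeff_X_pow]
  rw [Finset.sum_boole]
  by_cases h : ∃ i, m = Finsupp.single i k
  · obtain ⟨i, rfl⟩ := h
    have : (Finset.univ.filter fun j => Finsupp.single i k = Finsupp.single j k) = {i} := by
      ext j
      simp [Finsupp.single_left_inj hk, eq_comm]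
    rw [this, if_pos ⟨i, by simp [Finsupp.embDomain_single]⟩]
    simp
  · rw [if_neg, Finset.filter_eq_empty_iff.2 fun i _ hi => h ⟨i, hi⟩]
    · simp
    · rintro ⟨i, hi⟩
      have hiN : i ∈ (m.embDomain Fin.valEmbedding).support := by
        rw [hi]; simp [hk]
      rw [Finsupp.support_embDomain, Finset.mem_map] at hiN
      obtain ⟨j, -, rfl⟩ := hiN
      rw [← Finsupp.embDomain_single] at hi
      exact h ⟨j, Finsupp.embDomain_injective _ hi⟩

theorem toMultiset_sum_single_comp {ι α : Type*} [Fintype ι] (κ : ι → α) :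
    Finsupp.toMultiset (∑ i, Finsupp.single (κ i) 1) = Finset.univ.val.map κ := by
  simp only [Finsupp.toMultiset_sum, Finsupp.toMultiset_single, one_smul]
  rw [← Multiset.sum_map_singleton (Finset.univ.val.map κ), Multiset.map_map]
  rfl

theorem coeff_prod_X {ι α : Type*} [Fintype ι] [DecidableEq α] (κ : ι → α) (m : α →₀ ℕ) :
    coeff m (∏ i, X (κ i) : MvPowerSeries α ℤ) =
      if ∑ i, Finsupp.single (κ i) 1 = m then 1 else 0 := by
  simp only [X_def, prod_monomial, coeff_monomial, Finset.prod_const_one, eq_comm]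

/-- Every monomial of degree `k` arises from exactly one weakly increasing sequence. -/
theorem existsUnique_monotone {α : Type*} [LinearOrder α] {k : ℕ} (m : α →₀ ℕ)
    (hk : m.degree = k) :
    ∃! κ : Fin k → α, Monotone κ ∧ ∑ i, Finsupp.single (κ i) 1 = m := by
  -- The condition becomes an equality of multisets, and a multiset has exactly one sorted listing.
  have key (κ : Fin k → α) : ∑ i, Finsupp.single (κ i) 1 = m ↔
      (List.ofFn κ : Multiset α) = Finsupp.toMultiset m := by
    rw [← (Multiset.toFinsupp (α := α)).symm.injective.eq_iff]
    change Finsupp.toMultiset _ = Finsupp.toMultiset _ ↔ _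
    rw [toMultiset_sum_single_comp, Fin.univ_val_map]
  simp only [key]
  refine existsUnique_of_exists_of_unique ?_ ?_
  · have hl : ((Finsupp.toMultiset m).sort (· ≤ ·)).length = k := by
      rw [Multiset.length_sort, Finsupp.card_toMultiset, ← hk]
      rfl
    have hs := (Multiset.sort_eq (Finsupp.toMultiset m) (· ≤ ·))
    have hp := (Multiset.pairwise_sort (Finsupp.toMultiset m) (· ≤ ·))
    generalize (Finsupp.toMultiset m).sort (· ≤ ·) = l at hl hs hp
    subst hl
    refine ⟨l.get, hp.sortedLE.monotone_get, ?_⟩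
    rw [List.ofFn_get, hs]
  · rintro κ κ' ⟨hκ, h⟩ ⟨hκ', h'⟩
    refine List.ofFn_injective (List.Perm.eq_of_sortedLE hκ.sortedLE_ofFn hκ'.sortedLE_ofFn ?_)
    exact Multiset.coe_eq_coe.1 (h.trans h'.symm)

/-- The exponent of `a` is the size of the fibre of `κ` over `a`. -/
theorem sum_single_le_one_iff {ι α : Type*} [Fintype ι] (κ : ι → α) :
    (∀ a, (∑ i, Finsupp.single (κ i) 1 : α →₀ ℕ) a ≤ 1) ↔ Function.Injective κ := by
  classical
  simp only [Finsupp.finsetSum_apply, Finsupp.single_apply, Finset.sum_boole, Nat.cast_id,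
    Finset.card_le_one, Finset.mem_filter, Finset.mem_univ, true_and]
  exact ⟨fun h i j hij => h (κ j) i hij j rfl, fun h a i hi j hj => h (hi.trans hj.symm)⟩

open Classical in
theorem trunc_homog (N k : ℕ) :
    trunc N (homog k) = ∑ κ : Fin k → Fin N with Monotone κ, ∏ i, X (κ i) := by
  ext m
  simp only [coeff_trunc_homog, map_sum, coeff_prod_X]
  rw [Finset.sum_boole, Finset.filter_filter]
  split_ifs with h
  · obtain ⟨κ, hκ, hu⟩ := existsUnique_monotone m h
    rw [Finset.card_eq_one.2 ⟨κ, by ext κ'; simpa using ⟨hu κ', fun h => h ▸ hκ⟩⟩, Nat.cast_one]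
  · rw [Finset.filter_eq_empty_iff.2, Finset.card_empty, Nat.cast_zero]
    rintro κ - ⟨-, rfl⟩
    exact h (by simp)

open Classical in
theorem trunc_elem (N k : ℕ) :
    trunc N (elem k) = ∑ κ : Fin k → Fin N with StrictMono κ, ∏ i, X (κ i) := by
  ext m
  simp only [coeff_trunc_elem, map_sum, coeff_prod_X]
  rw [Finset.sum_boole, Finset.filter_filter]
  split_ifs with h
  · obtain ⟨κ, hκ, hu⟩ := existsUnique_monotone m h.1
    have hs : StrictMono κ := by
      refine hκ.1.strictMono_of_injective ((sum_single_le_one_iff κ).1 ?_)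
      rw [hκ.2]
      exact h.2
    rw [Finset.card_eq_one.2 ⟨κ, ?_⟩, Nat.cast_one]
    ext κ'
    simpa using ⟨fun h => hu κ' ⟨h.1.monotone, h.2⟩, fun h => h ▸ ⟨hs, hκ.2⟩⟩
  · rw [Finset.filter_eq_empty_iff.2, Finset.card_empty, Nat.cast_zero]
    rintro κ - ⟨hκ, rfl⟩
    exact h ⟨by simp, (sum_single_le_one_iff κ).2 hκ.injective⟩

/-- Gives access to the fundamental theorem of symmetric polynomials. -/
theorem trunc_elem_eq_esymm (N k : ℕ) :
    trunc N (elem k) = (MvPolynomial.esymm (Fin N) ℤ k : MvPowerSeries (Fin N) ℤ) := by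
  classical
  ext m
  rw [coeff_trunc_elem, MvPolynomial.coeff_coe, MvPolynomial.esymm_eq_sum_monomial]
  have h1 (t : Finset (Fin N)) (i : Fin N) :
      (∑ j ∈ t, Finsupp.single j 1 : Fin N →₀ ℕ) i = if i ∈ t then 1 else 0 := by
    simp [Finsupp.finsetSum_apply, Finsupp.single_apply]
  simp only [MvPolynomial.coeff_sum, MvPolynomial.coeff_monomial]
  rw [Finset.sum_boole]
  split_ifs with h
  · rw [Finset.card_eq_one.2 ⟨m.support, ?_⟩, Nat.cast_one]
    ext t
    simp only [Finset.mem_filter, Finset.mem_powersetCard_univ, Finset.mem_singleton]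
    constructor
    · rintro ⟨-, rfl⟩
      ext i
      simp [h1]
    · rintro rfl
      have h2 : ∀ i ∈ m.support, m i = 1 := fun i hi =>
        le_antisymm (h.2 i) (Nat.one_le_iff_ne_zero.2 (Finsupp.mem_support_iff.1 hi))
      refine ⟨?_, ?_⟩
      · rw [← h.1, Finsupp.degree_apply, Finset.sum_congr rfl h2]
        simp
      · ext i
        rw [h1]
        split_ifs with hi
        · exact (h2 i hi).symm
        · exact (Finsupp.notMem_support_iff.1 hi).symm
  · rw [Finset.filter_eq_empty_iff.2, Finset.card_empty, Nat.cast_zero]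
    rintro t ht rfl
    refine h ⟨?_, fun i => ?_⟩
    · rw [map_sum]
      simpa using ht
    · rw [h1]
      split_ifs <;> simp

end SymmFun

/-! ### The relation between the `e_k` and the `h_k` -/

namespace SymmFun

open MvPowerSeries

open Classical in
-- Squarefree divisors of a monomial correspond to subsets of its support, and a nonempty set has as
-- many even as odd subsets.
theorem sum_antidiagonal_squarefree {m : ℕ →₀ ℕ} (hm : m ≠ 0) :
    ∑ p ∈ Finset.HasAntidiagonal.antidiagonal m with ∀ i, p.1 i ≤ 1, (-1 : ℤ) ^ p.1.degree = 0 := by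
  classical
  have hs : m.support.Nonempty := Finsupp.support_nonempty_iff.2 hm
  rw [← Finset.sum_powerset_neg_one_pow_card_of_nonempty hs]
  have h1 (t : Finset ℕ) (i : ℕ) :
      (∑ j ∈ t, Finsupp.single j 1 : ℕ →₀ ℕ) i = if i ∈ t then 1 else 0 := by
    simp [Finsupp.finsetSum_apply, Finsupp.single_apply]
  refine Finset.sum_bij' (fun p _ => p.1.support)
    (fun t _ => (∑ j ∈ t, Finsupp.single j 1, m - ∑ j ∈ t, Finsupp.single j 1)) ?_ ?_ ?_ ?_ ?_
  · rintro ⟨a, b⟩ h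
    simp only [Finset.mem_filter, Finset.HasAntidiagonal.mem_antidiagonal] at h
    rw [Finset.mem_powerset, ← h.1]
    exact Finsupp.support_mono (self_le_add_right a b)
  · intro t ht
    rw [Finset.mem_powerset] at ht
    simp only [Finset.mem_filter, Finset.HasAntidiagonal.mem_antidiagonal]
    refine ⟨add_tsub_cancel_of_le fun i => ?_, fun i => ?_⟩
    · rw [h1]
      split_ifs with hi
      · exact Nat.one_le_iff_ne_zero.2 (Finsupp.mem_support_iff.1 (ht hi))
      · exact Nat.zero_le _
    · rw [h1]
      split_ifs <;> simp
  · rintro ⟨a, b⟩ h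
    simp only [Finset.mem_filter, Finset.HasAntidiagonal.mem_antidiagonal] at h
    have ha : ∑ j ∈ a.support, Finsupp.single j 1 = a := by
      ext i
      rw [h1]
      have := h.2 i
      split_ifs with hi <;> simp at hi <;> omega
    simp only [ha, Prod.mk.injEq, true_and]
    rw [← h.1, add_tsub_cancel_left]
  · intro t ht
    ext i
    simp [h1]
  · rintro ⟨a, b⟩ h
    simp only [Finset.mem_filter, Finset.HasAntidiagonal.mem_antidiagonal] at h
    have h2 : ∀ i ∈ a.support, a i = 1 := fun i hi =>
      le_antisymm (h.2 i) (Nat.one_le_iff_ne_zero.2 (Finsupp.mem_support_iff.1 hi))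
    simp only
    rw [Finsupp.degree_apply, Finset.sum_congr rfl h2]
    simp

/-- The relation between the elementary and the complete homogeneous symmetric functions. -/
theorem sum_antidiagonal_elem_homog {n : ℕ} (hn : n ≠ 0) :
    ∑ p ∈ Finset.HasAntidiagonal.antidiagonal n, (-1) ^ p.1 * elem p.1 * homog p.2 = 0 := by
  classical
  ext m
  have h1 : ∀ p : ℕ × ℕ, coeff m ((-1) ^ p.1 * elem p.1 * homog p.2) =
      ∑ q ∈ Finset.HasAntidiagonal.antidiagonal m with ∀ i, q.1 i ≤ 1,
        if (q.1.degree, q.2.degree) = p then (-1 : ℤ) ^ q.1.degree else 0 := by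
    rintro ⟨i, j⟩
    have : ((-1) ^ i * elem i * homog j : MvPowerSeries ℕ ℤ) =
        ((-1) ^ i : ℤ) • (elem i * homog j) := by
      simp [zsmul_eq_mul, mul_assoc]
    rw [this, map_smul, coeff_mul, Finset.sum_filter, smul_eq_mul, Finset.mul_sum]
    refine Finset.sum_congr rfl fun q _ => ?_
    change _ * ((if _ then (1 : ℤ) else 0) * (if _ then 1 else 0)) = _
    simp only [Prod.mk.injEq]
    split_ifs <;> simp_all
  simp only [map_sum, h1, map_zero]
  -- After the exchange, each factorisation of the monomial selects the single index pair given by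
  -- its two degrees.
  rw [Finset.sum_comm]
  by_cases hm : m.degree = n
  · refine Eq.trans ?_
      (sum_antidiagonal_squarefree (m := m) (by rintro rfl; simp at hm; exact hn hm.symm))
    refine Finset.sum_congr rfl fun q hq => ?_
    rw [Finset.sum_ite_eq, if_pos]
    simp only [Finset.mem_filter, Finset.HasAntidiagonal.mem_antidiagonal] at hq ⊢
    rw [← map_add, hq.1, hm]
  · refine Finset.sum_eq_zero fun q hq => Finset.sum_eq_zero fun p hp => if_neg ?_
    rintro rfl
    simp only [Finset.mem_filter, Finset.HasAntidiagonal.mem_antidiagonal] at hq hp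
    rw [← map_add, hq.1] at hp
    exact hm hp

theorem elem_zero : elem 0 = 1 := by
  classical
  ext m
  rw [coeff_one]
  change (if _ then _ else _) = _
  refine if_congr ?_ rfl rfl
  rw [Finsupp.degree_eq_zero_iff]
  exact ⟨fun h => h.1, by rintro rfl; simp⟩

theorem homog_zero : homog 0 = 1 := by
  classical
  ext m
  rw [coeff_one]
  change (if _ then _ else _) = _
  exact if_congr (Finsupp.degree_eq_zero_iff _) rfl rfl

end SymmFun

/-! ### Algebraic and linear independence -/

/-- If `∑ (-1) ^ i e_i h_j` over `i + j = n` vanishes for all `n > 0`, then each `h_k` is a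
polynomial in `e_1, …, e_k`. -/
theorem mem_of_sum_antidiagonal_eq_zero {A : Type*} [CommRing A] (S : Subring A) {e h : ℕ → A}
    {n : ℕ} (he0 : e 0 = 1) (hh0 : h 0 = 1)
    (hrel : ∀ k, k ≠ 0 → ∑ p ∈ Finset.HasAntidiagonal.antidiagonal k, (-1) ^ p.1 * e p.1 * h p.2 = 0)
    (he : ∀ k ≤ n, e k ∈ S) : ∀ k ≤ n, h k ∈ S := by
  intro k
  induction k using Nat.strong_induction_on with
  | _ k ih =>
    intro hk
    rcases Nat.eq_zero_or_pos k with rfl | hpos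
    · rw [hh0]; exact S.one_mem
    · have hr := hrel k hpos.ne'
      -- The term with `i = 0` is `h k` itself; all others involve only `h j` with `j < k`.
      rw [← Finset.add_sum_erase _ _ (Finset.HasAntidiagonal.mem_antidiagonal.2 (zero_add k) :
        (0, k) ∈ Finset.HasAntidiagonal.antidiagonal k)] at hr
      simp only [pow_zero, he0, one_mul] at hr
      rw [eq_neg_of_add_eq_zero_left hr]
      refine S.neg_mem (S.sum_mem fun p hp => ?_)
      simp only [Finset.mem_erase, Finset.HasAntidiagonal.mem_antidiagonal, ne_eq, Prod.ext_iff] at hp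
      refine S.mul_mem (S.mul_mem (S.pow_mem (S.neg_mem S.one_mem) _) (he _ ?_)) (ih _ ?_ ?_) <;>
        omega

/-- Up to the global sign `(-1) ^ k` the relation is symmetric, so `e` and `h` may exchange roles.
-/
theorem sum_antidiagonal_swap_eq_zero {A : Type*} [CommRing A] {e h : ℕ → A} {k : ℕ}
    (hrel : ∑ p ∈ Finset.HasAntidiagonal.antidiagonal k, (-1) ^ p.1 * e p.1 * h p.2 = 0) :
    ∑ p ∈ Finset.HasAntidiagonal.antidiagonal k, (-1) ^ p.1 * h p.1 * e p.2 = 0 := by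
  rw [← Finset.Nat.sum_antidiagonal_swap]
  rw [← mul_zero ((-1) ^ k), ← hrel, Finset.mul_sum]
  refine Finset.sum_congr rfl fun p hp => ?_
  rw [Finset.HasAntidiagonal.mem_antidiagonal] at hp
  simp only [Prod.fst_swap, Prod.snd_swap, ← hp, pow_add]
  have : ((-1 : A) ^ p.1) * (-1) ^ p.1 = 1 := by rw [← mul_pow]; simp
  linear_combination (-(-1) ^ p.2 * e p.1 * h p.2) * this

/-- A surjective endomorphism of a Noetherian ring is injective. -/
theorem RingHom.injective_of_surjective_of_isNoetherianRing {A : Type*} [CommRing A]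
    [IsNoetherianRing A] (φ : A →+* A) (hφ : Function.Surjective φ) : Function.Injective φ := by
  have hcoe (k : ℕ) : ⇑(φ ^ k) = φ^[k] := by
    induction k with
    | zero => rfl
    | succ k ih => rw [pow_succ, RingHom.mul_def, RingHom.coe_comp, ih, Function.iterate_succ]
  let K : ℕ →o Ideal A :=
    { toFun := fun k => RingHom.ker (φ ^ k)
      monotone' := monotone_nat_of_le_succ fun k x hx => by
        rw [RingHom.mem_ker, hcoe] at hx ⊢
        rw [Function.iterate_succ_apply', hx, map_zero] }
  obtain ⟨k, hk⟩ := monotone_stabilizes_iff_noetherian.2 ‹IsNoetherianRing A› K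
  rw [injective_iff_map_eq_zero]
  intro x hx
  -- With `x = φ^k y`, the equation `φ x = 0` puts `y` in the kernel of `φ^(k+1)`, which equals that
  -- of `φ^k`; hence `x = 0`.
  obtain ⟨y, rfl⟩ := hφ.iterate k x
  have hy : y ∈ K (k + 1) := by
    change y ∈ RingHom.ker (φ ^ (k + 1))
    rw [RingHom.mem_ker, hcoe, Function.iterate_succ_apply', hx]
  rw [← hk (k + 1) k.le_succ] at hy
  change y ∈ RingHom.ker (φ ^ k) at hy
  rwa [RingHom.mem_ker, hcoe] at hy

/-- If `∑ (-1) ^ i e_i h_j` over `i + j = n` vanishes for all `n > 0` and the `e_i` are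
algebraically independent, then so are the `h_i`. -/
theorem injective_eval_of_sum_antidiagonal_eq_zero {A : Type*} [CommRing A] {e h : ℕ → A}
    (he0 : e 0 = 1) (hh0 : h 0 = 1)
    (hrel : ∀ k, k ≠ 0 →
      ∑ p ∈ Finset.HasAntidiagonal.antidiagonal k, (-1) ^ p.1 * e p.1 * h p.2 = 0) {n : ℕ}
    (hinj : Function.Injective
      (MvPolynomial.eval₂Hom (Int.castRingHom A) fun i : Fin n => e (i + 1))) :
    Function.Injective
      (MvPolynomial.eval₂Hom (Int.castRingHom A) fun i : Fin n => h (i + 1)) := by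
  set E := MvPolynomial.eval₂Hom (Int.castRingHom A) fun i : Fin n => e (i + 1) with hE
  set H := MvPolynomial.eval₂Hom (Int.castRingHom A) fun i : Fin n => h (i + 1) with hH
  have hEr : ∀ k ≤ n, e k ∈ E.range := by
    rintro (_ | k) hk
    · rw [he0]; exact Subring.one_mem _
    · exact ⟨MvPolynomial.X ⟨k, hk⟩, by simp [hE]⟩
  have hHr : ∀ k ≤ n, h k ∈ H.range := by
    rintro (_ | k) hk
    · rw [hh0]; exact Subring.one_mem _
    · exact ⟨MvPolynomial.X ⟨k, hk⟩, by simp [hH]⟩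
  have h1 := mem_of_sum_antidiagonal_eq_zero _ he0 hh0 hrel hEr
  have h2 := mem_of_sum_antidiagonal_eq_zero _ hh0 he0
    (fun k hk => sum_antidiagonal_swap_eq_zero (hrel k hk)) hHr
  choose P hP using fun i : Fin n => h1 (i + 1) i.2
  choose Q hQ using fun i : Fin n => h2 (i + 1) i.2
  -- `φ` substitutes for each variable the polynomial expressing an `h` through the `e`s, so that `H
  -- = E ∘ φ`.
  let φ := MvPolynomial.bind₁ P
  have hφ : E.comp φ.toRingHom = H := by
    refine MvPolynomial.ringHom_ext (fun a => by simp [φ, hE, hH]) fun i => ?_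
    simpa [φ, hH] using hP i
  -- Each `e` is in turn a polynomial `Q i` in the `h`s; injectivity of `E` turns this into `φ (Q i)
  -- = X i`.
  have hsurj : Function.Surjective φ := by
    rw [← AlgHom.range_eq_top, eq_top_iff, ← MvPolynomial.adjoin_range_X, Algebra.adjoin_le_iff]
    rintro _ ⟨i, rfl⟩
    refine ⟨Q i, hinj ?_⟩
    have h3 := hQ i
    rw [← hφ] at h3
    refine h3.trans ?_
    simp [hE]
  have hφinj : Function.Injective φ.toRingHom :=
    RingHom.injective_of_surjective_of_isNoetherianRing φ.toRingHom hsurj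
  rw [← hφ, RingHom.coe_comp]
  exact hinj.comp hφinj

/-- The products of algebraically independent elements over the parts of the partitions of `n`
are linearly independent. -/
theorem linearIndependent_prod_parts {A : Type*} [CommRing A] {n : ℕ} {f : ℕ → A}
    (hf : Function.Injective (MvPolynomial.eval₂Hom (Int.castRingHom A) fun i : Fin n => f (i + 1))) :
    LinearIndependent ℤ fun μ : n.Partition => (μ.parts.map f).prod := by
  classical
  -- The product over the parts of `μ` is the image of the monomial in which variable `i` has the
  -- multiplicity of the part `i + 1` as exponent.
  let d (μ : n.Partition) : Fin n →₀ ℕ :=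
    Finsupp.equivFunOnFinite.symm fun i => μ.parts.count (i + 1 : ℕ)
  have hd (μ : n.Partition) (i : Fin n) : d μ i = μ.parts.count (i + 1 : ℕ) := rfl
  have hmem (μ : n.Partition) {j : ℕ} (hj : j ∈ μ.parts) : ∃ i : Fin n, (i + 1 : ℕ) = j := by
    have h1 := μ.parts_pos hj
    have h2 := μ.le_of_mem_parts hj
    exact ⟨⟨j - 1, by omega⟩, by simp; omega⟩
  have hinj : Function.Injective d := by
    intro μ ν h
    ext j
    by_cases hj : ∃ i : Fin n, (i + 1 : ℕ) = j
    · obtain ⟨i, rfl⟩ := hj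
      rw [← hd, ← hd, h]
    · rw [Multiset.count_eq_zero_of_notMem fun h => hj (hmem μ h),
        Multiset.count_eq_zero_of_notMem fun h => hj (hmem ν h)]
  let F := MvPolynomial.eval₂Hom (Int.castRingHom A) fun i : Fin n => f (i + 1)
  have heq : (fun μ : n.Partition => (μ.parts.map f).prod) =
      F.toAddMonoidHom.toIntLinearMap ∘ (MvPolynomial.basisMonomials (Fin n) ℤ ∘ d) := by
    funext μ
    simp only [Function.comp_apply, MvPolynomial.coe_basisMonomials]
    change _ = F (MvPolynomial.monomial (d μ) 1)
    rw [MvPolynomial.eval₂Hom_monomial, map_one, one_mul]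
    rw [Finsupp.prod_fintype _ _ (by simp), Finset.prod_multiset_map_count]
    have h := Finset.prod_map Finset.univ
      (⟨fun i : Fin n => (i + 1 : ℕ), fun i j h => by simpa [Fin.ext_iff] using h⟩ : Fin n ↪ ℕ)
      fun j => f j ^ μ.parts.count j
    refine Eq.trans (Finset.prod_subset ?_ ?_) h
    · intro j hj
      obtain ⟨i, hi⟩ := hmem μ (Multiset.mem_toFinset.1 hj)
      exact Finset.mem_map.2 ⟨i, Finset.mem_univ i, hi⟩
    · intro j _ hj
      rw [Multiset.count_eq_zero_of_notMem (by simpa using hj), pow_zero]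
  rw [heq]
  exact ((MvPolynomial.basisMonomials (Fin n) ℤ).linearIndependent.comp d hinj).map'
    _ (LinearMap.ker_eq_bot.2 hf)

namespace SymmFun

/-- The fundamental theorem of symmetric polynomials. Keeping `n` variables suffices, since the
parts of a partition of `n` are at most `n`. -/
theorem injective_eval_elem (n : ℕ) : Function.Injective
    (MvPolynomial.eval₂Hom (Int.castRingHom _) fun i : Fin n => trunc n (elem (i + 1))) := by
  have h : (MvPolynomial.eval₂Hom (Int.castRingHom _) fun i : Fin n => trunc n (elem (i + 1))) =
      MvPolynomial.coeToMvPowerSeries.ringHom.comp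
        (MvPolynomial.aeval (R := ℤ)
          fun i : Fin n => MvPolynomial.esymm (Fin n) ℤ (i + 1)).toRingHom := by
    refine MvPolynomial.ringHom_ext (by simp) fun i => ?_
    simp [trunc_elem_eq_esymm]
  rw [h]
  intro p q hpq
  refine MvPolynomial.esymmAlgHom_fin_injective ℤ le_rfl (Subtype.ext ?_)
  rw [MvPolynomial.esymmAlgHom_apply, MvPolynomial.esymmAlgHom_apply]
  exact MvPolynomial.coe_injective _ _ hpq

theorem injective_eval_homog (n : ℕ) : Function.Injective
    (MvPolynomial.eval₂Hom (Int.castRingHom _) fun i : Fin n => trunc n (homog (i + 1))) :=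
  injective_eval_of_sum_antidiagonal_eq_zero (e := fun k => trunc n (elem k))
    (h := fun k => trunc n (homog k)) (by simp only [elem_zero, map_one])
    (by simp only [homog_zero, map_one])
    (fun k hk => by simpa using congrArg (trunc n) (sum_antidiagonal_elem_homog hk))
    (injective_eval_elem n)

theorem linearIndependent_elemPart (n : ℕ) :
    LinearIndependent ℤ fun μ : n.Partition => elemPart μ := by
  refine LinearIndependent.of_comp (trunc n).toAddMonoidHom.toIntLinearMap ?_
  have h : (trunc n).toAddMonoidHom.toIntLinearMap ∘ (fun μ : n.Partition => elemPart μ) =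
      fun μ => (μ.parts.map fun k => trunc n (elem k)).prod := by
    funext μ
    simp [elemPart, map_multiset_prod]
  rw [h]
  exact linearIndependent_prod_parts (injective_eval_elem n)

theorem linearIndependent_homogPart (n : ℕ) :
    LinearIndependent ℤ fun μ : n.Partition => homogPart μ := by
  refine LinearIndependent.of_comp (trunc n).toAddMonoidHom.toIntLinearMap ?_
  have h : (trunc n).toAddMonoidHom.toIntLinearMap ∘ (fun μ : n.Partition => homogPart μ) =
      fun μ => (μ.parts.map fun k => trunc n (homog k)).prod := by
    funext μ
    simp [homogPart, map_multiset_prod]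
  rw [h]
  exact linearIndependent_prod_parts (injective_eval_homog n)

end SymmFun

/-! ### Components, and `e`, `h`, `p` of a type as sums over colourings -/

namespace Digraph

variable {V : Type*}

theorem componentOf_eq_of_adj {E : Digraph V} {v w : V} (h : E.Adj v w) :
    E.componentOf v = E.componentOf w := by
  by_cases hvw : v = w
  · rw [hvw]
  · exact SimpleGraph.ConnectedComponent.eq.2
      (SimpleGraph.Adj.reachable ((SimpleGraph.fromRel_adj _ _ _).2 ⟨hvw, Or.inl h⟩))

/-- A function that is constant along the arrows is constant on the components. -/
theorem eq_of_componentOf_eq {E : Digraph V} {α : Type*} {g : V → α}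
    (hg : ∀ a b, E.Adj a b → g a = g b) {v w : V} (h : E.componentOf v = E.componentOf w) :
    g v = g w := by
  obtain ⟨p⟩ : E.toSimpleGraphInclusive.Reachable v w := SimpleGraph.ConnectedComponent.eq.1 h
  induction p with
  | nil => rfl
  | cons hadj p ih =>
    refine Eq.trans ?_ (ih (SimpleGraph.ConnectedComponent.eq.2 ⟨p⟩))
    rcases ((SimpleGraph.fromRel_adj _ _ _).1 hadj).2 with h' | h'
    exacts [hg _ _ h', (hg _ _ h').symm]

theorem verts_componentOf_eq {E : Digraph V} {S : Set V} {v : V} (hv : v ∈ S)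
    (hS : ∀ a b, E.Adj a b → (a ∈ S ↔ b ∈ S))
    (hconn : ∀ w ∈ S, E.componentOf w = E.componentOf v) : (E.componentOf v).verts = S := by
  ext w
  refine ⟨fun h => ?_, fun h => mem_verts_iff.2 (hconn w h)⟩
  have := eq_of_componentOf_eq (g := fun a => a ∈ S) (fun a b hab => propext (hS a b hab))
    (mem_verts_iff.1 h)
  exact this.mpr hv

end Digraph

/-- The function `κ` maps pairs related by `A` to pairs related by `r`. -/
def Respects {W α : Type*} (A : W → W → Prop) (r : α → α → Prop) (κ : W → α) : Prop :=
  ∀ v w, A v w → r (κ v) (κ w)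

open Classical in
/-- Expansion of a product of sums over the functions on the fibres of `q`. -/
theorem prod_sum_fiber_eq {V C α R : Type*} [Fintype V] [Fintype C] [Fintype α] [CommSemiring R]
    (q : V → C) (x : α → R) (Q : ∀ c, ({v // q v = c} → α) → Prop) :
    ∏ c, ∑ κ : {v // q v = c} → α with Q c κ, ∏ v, x (κ v) =
      ∑ κ : V → α with ∀ c, Q c fun v => κ v, ∏ v, x (κ v) := by
  rw [Finset.prod_univ_sum]
  refine Finset.sum_bij' (fun p _ v => p (q v) ⟨v, rfl⟩) (fun κ _ c v => κ v) ?_ ?_ ?_ ?_ ?_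
  · intro p hp
    simp only [Fintype.mem_piFinset, Finset.mem_filter, Finset.mem_univ, true_and] at hp ⊢
    intro c
    convert hp c using 1
    funext ⟨v, hv⟩
    subst hv
    rfl
  · intro κ hκ
    simpa only [Fintype.mem_piFinset, Finset.mem_filter, Finset.mem_univ, true_and] using hκ
  · intro p _
    funext c ⟨v, hv⟩
    subst hv
    rfl
  · intro κ _
    rfl
  · intro p _
    rw [← Fintype.prod_fiberwise q]
    refine Finset.prod_congr rfl fun c _ => Finset.prod_congr rfl fun ⟨v, hv⟩ _ => ?_
    subst hv
    rfl

namespace Digraph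

open Classical

variable {V : Type*}

/-- No arrow joins two components, so a colouring respecting `E` is an independent choice of one on
each component. Used with `<`, `≤` and `=` for `e`, `h` and `p`. -/
theorem prod_parts_type [Fintype V] {α R : Type*} [Fintype α] [CommSemiring R] (E : Digraph V)
    (g : ℕ → R) (x : α → R) (r : α → α → Prop)
    (h : ∀ C : E.Component, g C.verts.ncard =
      ∑ κ : {v // E.componentOf v = C} → α with
        Respects (fun v w : {v // E.componentOf v = C} => E.Adj v w) r κ,
        ∏ v, x (κ v)) :
    (E.type.parts.map g).prod =
      ∑ κ : V → α with Respects E.Adj r κ, ∏ v, x (κ v) := by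
  have h1 : (E.type.parts.map g).prod = ∏ C : E.Component, g C.verts.ncard := by
    simp only [type, Multiset.map_map]
    rfl
  rw [h1, Finset.prod_congr rfl fun C _ => h C, prod_sum_fiber_eq]
  refine Finset.sum_congr (Finset.filter_congr fun κ _ => ?_) fun _ _ => rfl
  exact ⟨fun hκ v w hvw => hκ _ ⟨v, rfl⟩ ⟨w, (componentOf_eq_of_adj hvw).symm⟩ hvw,
    fun hκ C v w hvw => hκ v w hvw⟩

theorem sum_functions_on_path {α R : Type*} [Fintype V] [Fintype α] [CommSemiring R]
    {E : Digraph V} {C : E.Component} {k : ℕ} {f : Fin (k + 1) → V} (hf : Function.Injective f)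
    (hC : Set.range f = C.verts)
    (hadj : ∀ i j : Fin (k + 1), E.Adj (f i) (f j) ↔ (i : ℕ) + 1 = (j : ℕ))
    (x : α → R) (r : α → α → Prop) :
    ∑ κ : {v // E.componentOf v = C} → α with
        Respects (fun v w : {v // E.componentOf v = C} => E.Adj v w) r κ, ∏ v, x (κ v) =
      ∑ κ : Fin (k + 1) → α with
        Respects (fun i j : Fin (k + 1) => (i : ℕ) + 1 = j) r κ, ∏ i, x (κ i) := by
  let e : Fin (k + 1) ≃ {v // E.componentOf v = C} :=
    (Equiv.ofInjective f hf).trans (Equiv.setCongr hC)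
  have he (i) : (e i : V) = f i := rfl
  refine Finset.sum_equiv (Equiv.arrowCongr e.symm (Equiv.refl α)) (fun κ => ?_) fun κ _ => ?_
  · simp only [Finset.mem_filter, Finset.mem_univ, true_and]
    refine ⟨fun h i j hij => h _ _ ((hadj i j).2 hij), fun h v w hvw => ?_⟩
    obtain ⟨i, rfl⟩ := e.surjective v
    obtain ⟨j, rfl⟩ := e.surjective w
    exact h i j ((hadj i j).1 hvw)
  · simp only [Equiv.arrowCongr_apply, Function.comp_apply, Equiv.refl_apply, Equiv.symm_symm]
    exact (Equiv.prod_comp e fun v => x (κ v)).symm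

theorem respects_succ_iff {α : Type*} {k : ℕ} (r : α → α → Prop) (κ : Fin (k + 1) → α) :
    Respects (fun i j : Fin (k + 1) => (i : ℕ) + 1 = j) r κ ↔
      ∀ i : Fin k, r (κ i.castSucc) (κ i.succ) := by
  refine ⟨fun h i => h _ _ (by simp), fun h i j hij => ?_⟩
  obtain ⟨i, rfl⟩ : ∃ i' : Fin k, i'.castSucc = i := ⟨⟨i, by omega⟩, rfl⟩
  obtain rfl : i.succ = j := Fin.ext hij
  exact h i

theorem ncard_verts_of_range_eq [Finite V] {E : Digraph V} {C : E.Component} {k : ℕ}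
    {f : Fin (k + 1) → V} (hf : Function.Injective f) (hC : Set.range f = C.verts) :
    C.verts.ncard = k + 1 := by
  rw [← hC, ← Set.image_univ, Set.ncard_image_of_injective _ hf, Set.ncard_univ,
    Nat.card_eq_fintype_card, Fintype.card_fin]

theorem trunc_elemPart_type [Fintype V] {E : Digraph V}
    (hE : ∀ C : E.Component, E.IsPathOn C.verts) (N : ℕ) :
    SymmFun.trunc N (SymmFun.elemPart E.type) =
      ∑ κ : V → Fin N with Respects E.Adj (· < ·) κ, ∏ v, MvPowerSeries.X (κ v) := by
  rw [SymmFun.elemPart, map_multiset_prod, Multiset.map_map]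
  refine prod_parts_type E (SymmFun.trunc N ∘ SymmFun.elem) MvPowerSeries.X (· < ·) fun C => ?_
  obtain ⟨k, f, hf, hC, hadj⟩ := hE C
  rw [sum_functions_on_path hf hC hadj, ncard_verts_of_range_eq hf hC, Function.comp_apply,
    SymmFun.trunc_elem]
  refine Finset.sum_congr (Finset.filter_congr fun κ _ => ?_) fun _ _ => rfl
  rw [Fin.strictMono_iff_lt_succ]
  exact (respects_succ_iff _ _).symm

theorem trunc_homogPart_type [Fintype V] {E : Digraph V}
    (hE : ∀ C : E.Component, E.IsPathOn C.verts) (N : ℕ) :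
    SymmFun.trunc N (SymmFun.homogPart E.type) =
      ∑ κ : V → Fin N with Respects E.Adj (· ≤ ·) κ, ∏ v, MvPowerSeries.X (κ v) := by
  rw [SymmFun.homogPart, map_multiset_prod, Multiset.map_map]
  refine prod_parts_type E (SymmFun.trunc N ∘ SymmFun.homog) MvPowerSeries.X (· ≤ ·) fun C => ?_
  obtain ⟨k, f, hf, hC, hadj⟩ := hE C
  rw [sum_functions_on_path hf hC hadj, ncard_verts_of_range_eq hf hC, Function.comp_apply,
    SymmFun.trunc_homog]
  refine Finset.sum_congr (Finset.filter_congr fun κ _ => ?_) fun _ _ => rfl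
  rw [Fin.monotone_iff_le_succ]
  exact (respects_succ_iff _ _).symm

/-- A colouring constant along arrows gives a component a single colour `i`, contributing `X i` to
the power of its size. -/
theorem trunc_powerPart_type [Fintype V] (F : Digraph V) (N : ℕ) :
    SymmFun.trunc N (SymmFun.powerPart F.type) =
      ∑ κ : V → Fin N with Respects F.Adj (· = ·) κ, ∏ v, MvPowerSeries.X (κ v) := by
  rw [SymmFun.powerPart, map_multiset_prod, Multiset.map_map]
  refine prod_parts_type F (SymmFun.trunc N ∘ SymmFun.power) MvPowerSeries.X (· = ·) fun C => ?_
  obtain ⟨u, rfl⟩ := F.componentOf_surjective C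
  have hcard : (F.componentOf u).verts.ncard =
      Fintype.card {v // F.componentOf v = F.componentOf u} := by
    rw [← Nat.card_eq_fintype_card]; rfl
  have hpos : (F.componentOf u).verts.ncard ≠ 0 := by
    have : Nonempty {v // F.componentOf v = F.componentOf u} := ⟨⟨u, rfl⟩⟩
    rw [hcard]
    exact Fintype.card_ne_zero
  rw [Function.comp_apply, SymmFun.trunc_power hpos]
  refine Finset.sum_bij' (fun i _ _ => i) (fun κ _ => κ ⟨u, rfl⟩) ?_ ?_ ?_ ?_ ?_
  · simp [Respects]
  · simp
  · simp
  · intro κ hκ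
    simp only [Finset.mem_filter, Finset.mem_univ, true_and] at hκ
    funext ⟨v, hv⟩
    have := eq_of_componentOf_eq (E := F) (v := u) (w := v)
      -- The colouring lives on one component only; it is extended by `none` to all of `V`.
      (g := fun a => if h : F.componentOf a = F.componentOf u then some (κ ⟨a, h⟩) else none)
      (fun a b hab => ?_) hv.symm
    · simpa [hv] using this
    · have h1 := componentOf_eq_of_adj hab
      by_cases ha : F.componentOf a = F.componentOf u
      · rw [dif_pos ha, dif_pos (h1 ▸ ha), hκ ⟨a, ha⟩ ⟨b, h1 ▸ ha⟩ hab]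
      · rw [dif_neg ha, dif_neg (h1 ▸ ha)]
  · intro i _
    simp [hcard]

end Digraph

/-! ### Cycle covers as permutations -/

namespace Digraph

variable {V : Type*}

/-- The functional digraph of a permutation. -/
def ofPerm (σ : Equiv.Perm V) : Digraph V where
  Adj v w := σ v = w

theorem ofPerm_injective : Function.Injective (ofPerm : Equiv.Perm V → Digraph V) := by
  intro σ τ h
  ext v
  have : (ofPerm τ).Adj v (σ v) := h ▸ (rfl : (ofPerm σ).Adj v (σ v))
  exact this.symm

theorem adj_of_le_ofPerm {E : Digraph V} {σ : Equiv.Perm V} (h : E ≤ ofPerm σ) {v w : V}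
    (hvw : E.Adj v w) : σ v = w :=
  h hvw

theorem componentOf_ofPerm_eq_iff [Finite V] {σ : Equiv.Perm V} {v w : V} :
    (ofPerm σ).componentOf v = (ofPerm σ).componentOf w ↔ σ.SameCycle v w := by
  constructor
  · intro h
    refine (Quotient.exact (s := Equiv.Perm.SameCycle.setoid σ)
      (eq_of_componentOf_eq (g := Quotient.mk (Equiv.Perm.SameCycle.setoid σ)) ?_ h))
    rintro a _ rfl
    exact Quotient.sound (Equiv.Perm.sameCycle_apply_right.2 (Equiv.Perm.SameCycle.refl σ a))
  · intro h
    obtain ⟨i, rfl⟩ := h.exists_nat_pow_eq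
    induction i with
    | zero => rfl
    | succ i ih =>
      rw [ih ⟨i, rfl⟩, pow_succ', Equiv.Perm.mul_apply]
      exact componentOf_eq_of_adj rfl

theorem isCycleOn_ofPerm [Finite V] (σ : Equiv.Perm V) (C : (ofPerm σ).Component) :
    (ofPerm σ).IsCycleOn C.verts := by
  obtain ⟨v, rfl⟩ := (ofPerm σ).componentOf_surjective C
  have hv : v ∈ Function.periodicPts σ := by
    refine ⟨orderOf σ, orderOf_pos σ, ?_⟩
    rw [Function.IsPeriodicPt, Function.IsFixedPt, ← Equiv.Perm.coe_pow, pow_orderOf_eq_one]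
    rfl
  have hpos := Function.minimalPeriod_pos_of_mem_periodicPts hv
  -- The length of the cycle through `v` is its minimal period, written as `k + 1`.
  obtain ⟨k, hk⟩ := Nat.exists_eq_succ_of_ne_zero hpos.ne'
  have hinj : Function.Injective fun i : Fin (k + 1) => σ^[i] v := by
    intro i j hij
    refine Fin.ext (Function.iterate_injOn_Iio_minimalPeriod (f := σ) (x := v) ?_ ?_ hij)
    · rw [hk]; exact i.2
    · rw [hk]; exact j.2
  have hstep (i : Fin (k + 1)) : σ (σ^[i] v) = σ^[((i + 1 : Fin (k + 1)) : ℕ)] v := by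
    rw [← Function.iterate_succ_apply' (⇑σ), Fin.val_add_one]
    split_ifs with hi
    · rw [hi, Fin.val_last]
      have := Function.iterate_minimalPeriod (f := σ) (x := v)
      rwa [hk] at this
    · rfl
  refine ⟨k, fun i => σ^[i] v, hinj, ?_, fun i j => ?_⟩
  · ext w
    rw [mem_verts_iff, componentOf_ofPerm_eq_iff]
    constructor
    · rintro ⟨i, rfl⟩
      refine Equiv.Perm.SameCycle.symm ⟨(i : ℕ), ?_⟩
      rw [zpow_natCast, Equiv.Perm.coe_pow]
    · intro h
      obtain ⟨i, rfl⟩ := h.symm.exists_nat_pow_eq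
      refine ⟨⟨i % (k + 1), Nat.mod_lt _ k.succ_pos⟩, ?_⟩
      have := Function.iterate_mod_minimalPeriod_eq (f := σ) (x := v) (n := i)
      rw [hk] at this
      rw [Equiv.Perm.coe_pow]
      exact this
  · change σ (σ^[i] v) = σ^[j] v ↔ _
    rw [hstep]
    exact ⟨fun h => (hinj h).symm, fun h => by rw [h]⟩

/-- On a union of cycles every vertex has exactly one outgoing and at most one incoming arrow, so
the successor map is injective, hence bijective by finiteness. -/
theorem exists_perm_of_isCycleOn [Finite V] {F : Digraph V}
    (hF : ∀ C : F.Component, F.IsCycleOn C.verts) : ∃ σ : Equiv.Perm V, F = ofPerm σ := by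
  have hex (v : V) : ∃ w, ∀ u, F.Adj v u ↔ u = w := by
    obtain ⟨k, f, hf, hC, hadj⟩ := hF (F.componentOf v)
    obtain ⟨i, rfl⟩ : v ∈ Set.range f := hC ▸ mem_verts_iff.2 rfl
    refine ⟨f (i + 1), fun u => ⟨fun h => ?_, ?_⟩⟩
    · obtain ⟨j, rfl⟩ : u ∈ Set.range f :=
        hC ▸ mem_verts_iff.2 (componentOf_eq_of_adj h).symm
      rw [(hadj i j).1 h]
    · rintro rfl
      exact (hadj _ _).2 rfl
  choose s hs using hex
  have hinj : Function.Injective s := by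
    intro v w hvw
    have hv : F.Adj v (s v) := (hs _ _).2 rfl
    have hw : F.Adj w (s v) := (hs _ _).2 hvw
    obtain ⟨k, f, hf, hC, hadj⟩ := hF (F.componentOf (s v))
    obtain ⟨i, rfl⟩ : v ∈ Set.range f := hC ▸ mem_verts_iff.2 (componentOf_eq_of_adj hv)
    obtain ⟨j, rfl⟩ : w ∈ Set.range f := hC ▸ mem_verts_iff.2 (componentOf_eq_of_adj hw)
    obtain ⟨l, hl⟩ : s (f i) ∈ Set.range f := hC ▸ mem_verts_iff.2 rfl
    rw [← hl, hadj] at hv hw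
    rw [add_right_cancel (hv.symm.trans hw)]
  refine ⟨Equiv.ofBijective s (Finite.injective_iff_bijective.1 hinj), ?_⟩
  ext v w
  rw [hs]
  exact eq_comm

theorem isCycleCover_iff [Finite V] {D F : Digraph V} :
    D.IsCycleCover F ↔ ∃ σ : Equiv.Perm V, (∀ v, D.Adj v (σ v)) ∧ ofPerm σ = F := by
  constructor
  · rintro ⟨hle, hF⟩
    obtain ⟨σ, rfl⟩ := exists_perm_of_isCycleOn hF
    exact ⟨σ, fun v => hle rfl, rfl⟩
  · rintro ⟨σ, hσ, rfl⟩
    refine ⟨?_, isCycleOn_ofPerm σ⟩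
    rintro v _ rfl
    exact hσ v

open Classical in
/-- The permutations that only use arrows of `D`. -/
noncomputable def perms [Fintype V] (D : Digraph V) : Finset (Equiv.Perm V) :=
  Finset.univ.filter fun σ => ∀ v, D.Adj v (σ v)

theorem mem_perms [Fintype V] {D : Digraph V} {σ : Equiv.Perm V} :
    σ ∈ D.perms ↔ ∀ v, D.Adj v (σ v) := by
  simp [perms]

theorem mem_cycleCovers [Finite V] {D F : Digraph V} : F ∈ D.cycleCovers ↔ D.IsCycleCover F := by
  simp [cycleCovers]

theorem cycleCovers_eq_map [Fintype V] (D : Digraph V) :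
    D.cycleCovers = D.perms.map ⟨ofPerm, ofPerm_injective⟩ := by
  ext F
  simp [mem_cycleCovers, isCycleCover_iff, mem_perms]

theorem cycleSymm_eq_sum [Fintype V] (D : Digraph V) :
    D.cycleSymm = ∑ σ ∈ D.perms, SymmFun.powerPart (ofPerm σ).type := by
  rw [cycleSymm, cycleCovers_eq_map, Finset.sum_map]
  rfl

/-- A digraph all of whose components are paths. -/
def IsPaths (E : Digraph V) : Prop :=
  ∀ C : E.Component, E.IsPathOn C.verts

end Digraph

/-! ### Disjoint unions of paths, and subdigraphs of a permutation -/

namespace Digraph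

variable {V : Type*}

namespace IsPaths

variable {E : Digraph V}

theorem right_unique (hE : E.IsPaths) {v w w' : V} (h : E.Adj v w) (h' : E.Adj v w') :
    w = w' := by
  obtain ⟨k, f, hf, hC, hadj⟩ := hE (E.componentOf v)
  obtain ⟨i, rfl⟩ : v ∈ Set.range f := hC ▸ mem_verts_iff.2 rfl
  obtain ⟨j, rfl⟩ : w ∈ Set.range f := hC ▸ mem_verts_iff.2 (componentOf_eq_of_adj h).symm
  obtain ⟨j', rfl⟩ : w' ∈ Set.range f := hC ▸ mem_verts_iff.2 (componentOf_eq_of_adj h').symm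
  rw [hadj] at h h'
  rw [Fin.ext (h.symm.trans h')]

theorem left_unique (hE : E.IsPaths) {v v' w : V} (h : E.Adj v w) (h' : E.Adj v' w) :
    v = v' := by
  obtain ⟨k, f, hf, hC, hadj⟩ := hE (E.componentOf w)
  obtain ⟨i, rfl⟩ : w ∈ Set.range f := hC ▸ mem_verts_iff.2 rfl
  obtain ⟨j, rfl⟩ : v ∈ Set.range f := hC ▸ mem_verts_iff.2 (componentOf_eq_of_adj h)
  obtain ⟨j', rfl⟩ : v' ∈ Set.range f := hC ▸ mem_verts_iff.2 (componentOf_eq_of_adj h')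
  rw [hadj] at h h'
  rw [Fin.ext (Nat.succ_injective (h.trans h'.symm))]

theorem exists_terminal (hE : E.IsPaths) (C : E.Component) :
    ∃ v, E.componentOf v = C ∧ ∀ u, ¬ E.Adj v u := by
  obtain ⟨k, f, hf, hC, hadj⟩ := hE C
  have hl : E.componentOf (f (Fin.last k)) = C := mem_verts_iff.1 (hC ▸ ⟨_, rfl⟩)
  refine ⟨f (Fin.last k), hl, fun u hu => ?_⟩
  obtain ⟨j, rfl⟩ : u ∈ Set.range f :=
    hC ▸ mem_verts_iff.2 ((componentOf_eq_of_adj hu).symm.trans hl)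
  have := (hadj _ _).1 hu
  have := j.2
  simp at *
  omega

theorem exists_initial (hE : E.IsPaths) (C : E.Component) :
    ∃ v, E.componentOf v = C ∧ ∀ u, ¬ E.Adj u v := by
  obtain ⟨k, f, hf, hC, hadj⟩ := hE C
  have hl : E.componentOf (f 0) = C := mem_verts_iff.1 (hC ▸ ⟨_, rfl⟩)
  refine ⟨f 0, hl, fun u hu => ?_⟩
  obtain ⟨j, rfl⟩ : u ∈ Set.range f :=
    hC ▸ mem_verts_iff.2 ((componentOf_eq_of_adj hu).trans hl)
  have := (hadj _ _).1 hu
  simp at this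

theorem terminal_unique (hE : E.IsPaths) {v w : V} (h : E.componentOf v = E.componentOf w)
    (hv : ∀ u, ¬ E.Adj v u) (hw : ∀ u, ¬ E.Adj w u) : v = w := by
  obtain ⟨k, f, hf, hC, hadj⟩ := hE (E.componentOf w)
  obtain ⟨i, rfl⟩ : v ∈ Set.range f := hC ▸ mem_verts_iff.2 h
  obtain ⟨j, rfl⟩ : w ∈ Set.range f := hC ▸ mem_verts_iff.2 rfl
  have key (l : Fin (k + 1)) (hl : ∀ u, ¬ E.Adj (f l) u) : (l : ℕ) = k := by
    by_contra hne
    exact hl (f ⟨l + 1, by omega⟩) ((hadj _ _).2 rfl)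
  rw [Fin.ext ((key i hv).trans (key j hw).symm)]

theorem initial_unique (hE : E.IsPaths) {v w : V} (h : E.componentOf v = E.componentOf w)
    (hv : ∀ u, ¬ E.Adj u v) (hw : ∀ u, ¬ E.Adj u w) : v = w := by
  obtain ⟨k, f, hf, hC, hadj⟩ := hE (E.componentOf w)
  obtain ⟨i, rfl⟩ : v ∈ Set.range f := hC ▸ mem_verts_iff.2 h
  obtain ⟨j, rfl⟩ : w ∈ Set.range f := hC ▸ mem_verts_iff.2 rfl
  have key (l : Fin (k + 1)) (hl : ∀ u, ¬ E.Adj u (f l)) : (l : ℕ) = 0 := by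
    by_contra hne
    exact hl (f ⟨l - 1, by omega⟩) ((hadj _ _).2 (Nat.sub_add_cancel (Nat.pos_of_ne_zero hne)))
  rw [Fin.ext ((key i hv).trans (key j hw).symm)]

end IsPaths

section Subdigraph

variable {E : Digraph V} {σ : Equiv.Perm V}

theorem adj_apply_iff (h : E ≤ ofPerm σ) {v : V} : E.Adj v (σ v) ↔ ∃ u, E.Adj v u := by
  refine ⟨fun hv => ⟨_, hv⟩, ?_⟩
  rintro ⟨u, hu⟩
  rwa [adj_of_le_ofPerm h hu]

theorem sameCycle_of_componentOf_eq [Finite V] (h : E ≤ ofPerm σ) {v w : V}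
    (hvw : E.componentOf v = E.componentOf w) : σ.SameCycle v w := by
  rw [← componentOf_ofPerm_eq_iff]
  exact eq_of_componentOf_eq (fun a b hab => componentOf_eq_of_adj (h hab)) hvw

/-- From any vertex one can follow the arrows of `E` to the end of its path and then back to the
beginning. -/
theorem exists_maximal_path [Finite V] (h : E ≤ ofPerm σ) {v w : V} (hvw : σ.SameCycle v w)
    (hw : ¬ E.Adj w (σ w)) : ∃ (b : V) (k : ℕ), E.componentOf b = E.componentOf v ∧
      (∀ i < k, E.Adj ((σ ^ i) b) (σ ((σ ^ i) b))) ∧ ¬ E.Adj ((σ ^ k) b) (σ ((σ ^ k) b)) ∧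
      ¬ E.Adj (σ⁻¹ b) b := by
  classical
  obtain ⟨m₀, hm₀⟩ := hvw.exists_nat_pow_eq
  have hex : ∃ m, ¬ E.Adj ((σ ^ m) v) (σ ((σ ^ m) v)) := ⟨m₀, by rwa [hm₀]⟩
  set m := Nat.find hex
  have hm : ¬ E.Adj ((σ ^ m) v) (σ ((σ ^ m) v)) := Nat.find_spec hex
  have hm' : ∀ i < m, E.Adj ((σ ^ i) v) (σ ((σ ^ i) v)) :=
    fun i hi => not_not.1 (Nat.find_min hex hi)
  have hconn : ∀ i ≤ m, E.componentOf ((σ ^ i) v) = E.componentOf v := by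
    intro i
    induction i with
    | zero => intro _; rfl
    | succ i ih =>
      intro hi
      rw [← ih (by omega), pow_succ', Equiv.Perm.mul_apply]
      exact (componentOf_eq_of_adj (hm' i hi)).symm
  set s := (σ ^ m) v
  have hs : E.componentOf s = E.componentOf v := hconn m le_rfl
  have hex' : ∃ k, ¬ E.Adj ((σ⁻¹ ^ (k + 1)) s) ((σ⁻¹ ^ k) s) := by
    -- Going back all the way around would return to `s`, which has no outgoing arrow in `E`.
    refine ⟨orderOf σ - 1, fun hadj => hm ?_⟩
    rw [Nat.sub_add_cancel (orderOf_pos σ), inv_pow, pow_orderOf_eq_one, inv_one] at hadj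
    exact (adj_apply_iff h).2 ⟨_, hadj⟩
  set k := Nat.find hex'
  have hk : ¬ E.Adj ((σ⁻¹ ^ (k + 1)) s) ((σ⁻¹ ^ k) s) := Nat.find_spec hex'
  have hk' : ∀ i < k, E.Adj ((σ⁻¹ ^ (i + 1)) s) ((σ⁻¹ ^ i) s) :=
    fun i hi => not_not.1 (Nat.find_min hex' hi)
  have hconn' : ∀ i ≤ k, E.componentOf ((σ⁻¹ ^ i) s) = E.componentOf s := by
    intro i
    induction i with
    | zero => intro _; rfl
    | succ i ih =>
      intro hi
      rw [← ih (by omega)]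
      exact componentOf_eq_of_adj (hk' i hi)
  have hpow (i : ℕ) (hi : i ≤ k) : (σ ^ i) ((σ⁻¹ ^ k) s) = (σ⁻¹ ^ (k - i)) s := by
    rw [← Equiv.Perm.mul_apply, inv_pow, inv_pow]
    congr 1
    rw [mul_inv_eq_iff_eq_mul, eq_inv_mul_iff_mul_eq, ← pow_add]
    congr 1
    omega
  refine ⟨(σ⁻¹ ^ k) s, k, (hconn' k le_rfl).trans hs, fun i hi => ?_, ?_, ?_⟩
  · rw [hpow i hi.le, adj_apply_iff h]
    have := hk' (k - i - 1) (by omega)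
    rw [Nat.sub_add_cancel (by omega)] at this
    exact ⟨_, this⟩
  · rw [hpow k le_rfl, Nat.sub_self]
    exact hm
  · rwa [← Equiv.Perm.mul_apply, ← pow_succ']

/-- The only obstruction to being a union of paths is a complete cycle of `σ`. The component of `v`
is found by walking to its end and then back to its beginning. -/
theorem isPaths_of_forall_sameCycle [Finite V] (h : E ≤ ofPerm σ)
    (hit : ∀ v, ∃ w, σ.SameCycle v w ∧ ¬ E.Adj w (σ w)) : E.IsPaths := by
  intro C
  obtain ⟨v, rfl⟩ := E.componentOf_surjective C
  obtain ⟨w, hvw, hw⟩ := hit v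
  obtain ⟨b, k, hb, hstep, hend, hbegin⟩ := exists_maximal_path h hvw hw
  -- A repetition would identify the end of the path with an earlier vertex, which has an outgoing
  -- arrow.
  have hlt {i j : ℕ} (hij : i < j) (hj : j ≤ k) : (σ ^ i) b ≠ (σ ^ j) b := by
    intro heq
    have h1 : (σ ^ (j - i)) b = b := by
      apply (σ ^ i).injective
      rw [← Equiv.Perm.mul_apply, ← pow_add, Nat.add_sub_cancel' hij.le, heq]
    have h2 : (σ ^ k) b = (σ ^ (k - (j - i))) b := by
      conv_rhs => rw [← h1]
      rw [← Equiv.Perm.mul_apply, ← pow_add]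
      congr 2
      omega
    rw [h2] at hend
    exact hend (hstep _ (by omega))
  have hinj : Function.Injective fun i : Fin (k + 1) => (σ ^ (i : ℕ)) b := by
    intro i j hij
    by_contra hne
    rcases lt_or_gt_of_ne (Fin.val_ne_iff.2 hne) with hlt' | hlt'
    · exact hlt hlt' (by omega) hij
    · exact hlt hlt' (by omega) hij.symm
  refine ⟨k, fun i => (σ ^ (i : ℕ)) b, hinj, ?_, fun i j => ?_⟩
  · rw [← hb]
    refine (verts_componentOf_eq (S := Set.range fun i : Fin (k + 1) => (σ ^ (i : ℕ)) b)
      ⟨0, rfl⟩ (fun x y hxy => ?_) ?_).symm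
    · obtain rfl := adj_of_le_ofPerm h hxy
      constructor
      · rintro ⟨i, rfl⟩
        have hi : (i : ℕ) ≠ k := fun hi => hend (hi ▸ hxy)
        refine ⟨⟨i + 1, by omega⟩, ?_⟩
        simp only [pow_succ', Equiv.Perm.mul_apply]
      · rintro ⟨i, hi⟩
        rcases Nat.eq_zero_or_pos (i : ℕ) with h0 | h0
        · simp only [h0, pow_zero, Equiv.Perm.one_apply] at hi
          refine absurd ?_ hbegin
          rw [hi]
          simpa using hxy
        · refine ⟨⟨i - 1, by omega⟩, σ.injective ?_⟩
          rw [← hi, ← Equiv.Perm.mul_apply, ← pow_succ']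
          simp only [Nat.sub_add_cancel h0]
    · rintro _ ⟨⟨i, hi⟩, rfl⟩
      simp only
      induction i with
      | zero => rfl
      | succ i ih =>
        rw [← ih (by omega), pow_succ', Equiv.Perm.mul_apply]
        exact (componentOf_eq_of_adj (hstep i (by omega))).symm
  · constructor
    · intro hij
      have hi : (i : ℕ) ≠ k := by
        intro hi
        simp only [hi] at hij
        exact hend ((adj_apply_iff h).2 ⟨_, hij⟩)
      have h1 := adj_of_le_ofPerm h hij
      have h2 := @hinj ⟨i + 1, by omega⟩ j (by
        simp only [pow_succ', Equiv.Perm.mul_apply]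
        exact h1)
      rw [← h2]
    · intro hij
      have := hstep i (by omega)
      rwa [← Equiv.Perm.mul_apply, ← pow_succ', hij] at this

theorem isPaths_iff_forall_sameCycle [Finite V] (h : E ≤ ofPerm σ) :
    E.IsPaths ↔ ∀ v, ∃ w, σ.SameCycle v w ∧ ¬ E.Adj w (σ w) := by
  refine ⟨fun hE v => ?_, isPaths_of_forall_sameCycle h⟩
  obtain ⟨w, hw, hwt⟩ := hE.exists_terminal (E.componentOf v)
  exact ⟨w, sameCycle_of_componentOf_eq h hw.symm, hwt _⟩

end Subdigraph

end Digraph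

/-! ### Sign cancellation over the path covers of a permutation -/

/-- Each fibre over `U` contributes its nonempty subsets, with alternating sum `-1`. In the
induction, the sums of both sides over all `T ⊆ U` agree, being alternating sums over full power
sets that are both trivial or both not; the terms with `T ≠ U` then cancel. -/
theorem sum_neg_one_pow_card_of_image_eq {V C : Type*} [Fintype V] [DecidableEq C]
    {q : V → C} (hq : Function.Surjective q) (U : Finset C) :
    ∑ S : Finset V with S.image q = U, (-1 : ℤ) ^ S.card = (-1) ^ U.card := by
  classical
  induction U using Finset.strongInduction with
  | H U ih =>
    have h1 : ∑ T ∈ U.powerset, ∑ S : Finset V with S.image q = T, (-1 : ℤ) ^ S.card =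
        ∑ T ∈ U.powerset, (-1 : ℤ) ^ T.card := by
      have h2 : ∑ T ∈ U.powerset, ∑ S : Finset V with S.image q = T, (-1 : ℤ) ^ S.card =
          ∑ S ∈ (Finset.univ.filter fun v => q v ∈ U).powerset, (-1 : ℤ) ^ S.card := by
        rw [← Finset.sum_fiberwise_of_maps_to (t := U.powerset) (g := fun S : Finset V => S.image q)]
        · refine Finset.sum_congr rfl fun T hT => Finset.sum_congr ?_ fun _ _ => rfl
          ext S
          simp only [Finset.mem_filter, Finset.mem_univ, true_and, Finset.mem_powerset]
          refine ⟨fun h => ⟨fun v hv => ?_, h⟩, fun h => h.2⟩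
          simp only [Finset.mem_filter, Finset.mem_univ, true_and]
          exact Finset.mem_powerset.1 hT (h ▸ Finset.mem_image_of_mem q hv)
        · intro S hS
          rw [Finset.mem_powerset] at hS ⊢
          intro c hc
          obtain ⟨v, hv, rfl⟩ := Finset.mem_image.1 hc
          simpa using hS hv
      rw [h2, Finset.sum_powerset_neg_one_pow_card, Finset.sum_powerset_neg_one_pow_card]
      refine if_congr ?_ rfl rfl
      rw [Finset.filter_eq_empty_iff, Finset.eq_empty_iff_forall_notMem]
      refine ⟨fun h c => ?_, fun h v _ => h _⟩
      obtain ⟨v, rfl⟩ := hq c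
      exact h (Finset.mem_univ v)
    rw [← Finset.add_sum_erase _ _ (Finset.mem_powerset_self U),
      ← Finset.add_sum_erase (a := U) _ _ (Finset.mem_powerset_self U)] at h1
    rw [Finset.sum_congr rfl fun T hT => ih T ?_] at h1
    · exact add_right_cancel h1
    · rw [Finset.mem_erase, Finset.mem_powerset] at hT
      exact Finset.ssubset_iff_subset_ne.2 ⟨hT.2, hT.1⟩

namespace Digraph

open Classical

variable {V : Type*}

/-- A function that weakly decreases around a finite cycle returns to its starting value, so no step
is strict. -/
theorem apply_eq_of_forall_sameCycle_le [Finite V] {α : Type*} [LinearOrder α] {σ : Equiv.Perm V} {κ : V → α} {v : V}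
    (h : ∀ w, σ.SameCycle v w → κ (σ w) ≤ κ w) : κ (σ v) = κ v := by
  refine le_antisymm (h v (Equiv.Perm.SameCycle.refl σ v)) ?_
  have key (i : ℕ) : κ ((σ ^ i) (σ v)) ≤ κ (σ v) := by
    induction i with
    | zero => exact le_rfl
    | succ i ih =>
      rw [pow_succ', Equiv.Perm.mul_apply]
      refine (h _ ?_).trans ih
      exact Equiv.Perm.sameCycle_pow_right.2
        (Equiv.Perm.sameCycle_apply_right.2 (Equiv.Perm.SameCycle.refl σ v))
  obtain ⟨i, hi⟩ := (Equiv.Perm.sameCycle_apply_left.2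
    (Equiv.Perm.SameCycle.refl σ v)).exists_nat_pow_eq
  have hle := key i
  rwa [hi] at hle

theorem apply_eq_of_forall_sameCycle_ge [Finite V] {α : Type*} [LinearOrder α] {σ : Equiv.Perm V} {κ : V → α} {v : V}
    (h : ∀ w, σ.SameCycle v w → κ w ≤ κ (σ w)) : κ (σ v) = κ v :=
  apply_eq_of_forall_sameCycle_le (α := αᵒᵈ) h

/-- The arrows of `ofPerm σ` that do not start in `S`. -/
def cut (σ : Equiv.Perm V) (S : Finset V) : Digraph V where
  Adj v w := σ v = w ∧ v ∉ S

theorem cut_le (σ : Equiv.Perm V) (S : Finset V) : cut σ S ≤ ofPerm σ :=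
  fun _ _ h => h.1

theorem respects_cut_iff {α : Type*} {σ : Equiv.Perm V} {S : Finset V} {r : α → α → Prop} {κ : V → α} :
    Respects (cut σ S).Adj r κ ↔ ∀ v, v ∉ S → r (κ v) (κ (σ v)) := by
  refine ⟨fun h v hv => h v _ ⟨rfl, hv⟩, ?_⟩
  rintro h v _ ⟨rfl, hv⟩
  exact h v hv

theorem respects_ofPerm_iff {α : Type*} {σ : Equiv.Perm V} {r : α → α → Prop} {κ : V → α} :
    Respects (ofPerm σ).Adj r κ ↔ ∀ v, r (κ v) (κ (σ v)) := by
  refine ⟨fun h v => h v _ rfl, ?_⟩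
  rintro h v _ rfl
  exact h v

theorem isPaths_cut_iff [Finite V] {σ : Equiv.Perm V} {S : Finset V} :
    (cut σ S).IsPaths ↔ ∀ v, ∃ w, σ.SameCycle v w ∧ w ∈ S := by
  rw [isPaths_iff_forall_sameCycle (cut_le σ S)]
  simp [cut]

theorem isPaths_cut_of_respects_lt [Finite V] {α : Type*} [LinearOrder α] {σ : Equiv.Perm V} {S : Finset V} {κ : V → α}
    (h : Respects (cut σ S).Adj (· < ·) κ) : (cut σ S).IsPaths := by
  rw [respects_cut_iff] at h
  rw [isPaths_cut_iff]
  intro v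
  by_contra! hv
  exact (h v (hv v (Equiv.Perm.SameCycle.refl σ v))).ne'
    (apply_eq_of_forall_sameCycle_ge fun w hw => (h w (hv w hw)).le)

variable [Fintype V]

/-- The arrows kept may be any set of ascents of `κ`; being paths is automatic, as no cycle consists
of ascents. The alternating sum vanishes unless there is no ascent, which forces `κ` to be constant
on cycles. -/
theorem sum_isPaths_cut_respects_lt {α : Type*} [LinearOrder α] (σ : Equiv.Perm V) (κ : V → α) :
    ∑ S : Finset V with (cut σ S).IsPaths ∧ Respects (cut σ S).Adj (· < ·) κ,
      (-1 : ℤ) ^ (Fintype.card V - S.card) =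
      if Respects (ofPerm σ).Adj (· = ·) κ then 1 else 0 := by
  have h1 : ∑ S : Finset V with (cut σ S).IsPaths ∧ Respects (cut σ S).Adj (· < ·) κ,
      (-1 : ℤ) ^ (Fintype.card V - S.card) =
      ∑ T ∈ (Finset.univ.filter fun v => κ v < κ (σ v)).powerset, (-1 : ℤ) ^ T.card := by
    refine Finset.sum_bij' (fun S _ => Sᶜ) (fun T _ => Tᶜ) ?_ ?_ ?_ ?_ ?_
    · intro S hS
      rw [Finset.mem_filter, respects_cut_iff] at hS
      rw [Finset.mem_powerset]
      intro v hv
      simpa using hS.2.2 v (Finset.mem_compl.1 hv)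
    · intro T hT
      have h : Respects (cut σ Tᶜ).Adj (· < ·) κ := by
        rw [respects_cut_iff]
        intro v hv
        simpa using Finset.mem_powerset.1 hT (by simpa using hv)
      simpa only [Finset.mem_filter, Finset.mem_univ, true_and] using
        ⟨isPaths_cut_of_respects_lt h, h⟩
    · simp
    · simp
    · intro S _
      rw [Finset.card_compl]
  rw [h1, Finset.sum_powerset_neg_one_pow_card]
  refine if_congr ?_ rfl rfl
  simp only [Finset.filter_eq_empty_iff, Finset.mem_univ, true_imp_iff, not_lt,
    respects_ofPerm_iff]
  exact ⟨fun h v => (apply_eq_of_forall_sameCycle_le fun w _ => @h w).symm, fun h v => (h v).ge⟩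

/-- Cutting at `S` leaves paths exactly when `S` meets every cycle, that is, when `S` maps onto the
set of components. -/
theorem sum_isPaths_cut (σ : Equiv.Perm V) :
    ∑ S : Finset V with (cut σ S).IsPaths, (-1 : ℤ) ^ S.card =
      (-1) ^ Fintype.card (ofPerm σ).Component := by
  have h := sum_neg_one_pow_card_of_image_eq (ofPerm σ).componentOf_surjective Finset.univ
  rw [Finset.card_univ] at h
  rw [← h]
  refine Finset.sum_congr (Finset.filter_congr fun S _ => ?_) fun _ _ => rfl
  rw [isPaths_cut_iff, Finset.eq_univ_iff_forall]
  simp only [Finset.mem_image, ← componentOf_ofPerm_eq_iff]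
  constructor
  · intro h C
    obtain ⟨v, rfl⟩ := (ofPerm σ).componentOf_surjective C
    obtain ⟨w, hw, hS⟩ := h v
    exact ⟨w, hS, hw.symm⟩
  · intro h v
    obtain ⟨w, hS, hw⟩ := h ((ofPerm σ).componentOf v)
    exact ⟨w, hw.symm, hS⟩

/-- If `κ` is constant on cycles, it restricts nothing and `sum_isPaths_cut` applies. Otherwise some
cycle has both an ascent and a descent, and toggling the cut at the ascent reverses the sign. -/
theorem sum_isPaths_cut_respects_le {α : Type*} [LinearOrder α] (σ : Equiv.Perm V) (κ : V → α) :
    ∑ S : Finset V with (cut σ S).IsPaths ∧ Respects (cut σ S).Adj (· ≤ ·) κ, (-1 : ℤ) ^ S.card =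
      if Respects (ofPerm σ).Adj (· = ·) κ then (-1) ^ Fintype.card (ofPerm σ).Component
      else 0 := by
  simp only [respects_cut_iff, respects_ofPerm_iff]
  split_ifs with hκ
  · rw [← sum_isPaths_cut]
    refine Finset.sum_congr (Finset.filter_congr fun S _ => ?_) fun _ _ => rfl
    exact ⟨fun h => h.1, fun h => ⟨h, fun v _ => (hκ v).le⟩⟩
  · push Not at hκ
    obtain ⟨u, hu⟩ := hκ
    obtain ⟨a, hua, ha⟩ : ∃ w, σ.SameCycle u w ∧ κ w < κ (σ w) := by
      by_contra! h
      exact hu (apply_eq_of_forall_sameCycle_le h).symm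
    obtain ⟨b, hub, hb⟩ : ∃ w, σ.SameCycle u w ∧ κ (σ w) < κ w := by
      by_contra! h
      exact hu (apply_eq_of_forall_sameCycle_ge h).symm
    have hab : b ≠ a := by
      rintro rfl
      exact lt_asymm ha hb
    have hmem (S : Finset V) (v : V) (hv : v ≠ a) : v ∈ symmDiff S {a} ↔ v ∈ S := by
      simp [Finset.mem_symmDiff, hv]
    refine Finset.sum_involution (fun S _ => symmDiff S {a}) ?_ ?_ ?_ ?_
    · intro S _
      by_cases haS : a ∈ S
      · have : symmDiff S {a} = S.erase a := by
          ext v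
          by_cases hv : v = a <;> simp [Finset.mem_symmDiff, hv, haS]
        rw [this, ← Finset.card_erase_add_one haS, pow_succ]
        ring
      · have : symmDiff S {a} = insert a S := by
          ext v
          by_cases hv : v = a <;> simp [Finset.mem_symmDiff, hv, haS]
        rw [this, Finset.card_insert_of_notMem haS, pow_succ]
        ring
    · intro S _ _ h
      have : a ∈ symmDiff S {a} ↔ a ∉ S := by simp [Finset.mem_symmDiff]
      rw [h] at this
      tauto
    · intro S hS
      simp only [Finset.mem_filter, Finset.mem_univ, true_and, isPaths_cut_iff] at hS ⊢
      -- A descent must be cut, so its cycle remains cut at `b` even when the cut at `a` is removed.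
      have hbS : b ∈ S := by
        by_contra hbS
        exact absurd (hS.2 b hbS) (not_le.2 hb)
      refine ⟨fun v => ?_, fun v hv => ?_⟩
      · obtain ⟨w, hvw, hw⟩ := hS.1 v
        by_cases hwa : w = a
        · subst hwa
          exact ⟨b, hvw.trans (hua.symm.trans hub), (hmem S b hab).2 hbS⟩
        · exact ⟨w, hvw, (hmem S w hwa).2 hw⟩
      · by_cases hva : v = a
        · exact hva ▸ ha.le
        · exact hS.2 v fun h => hv ((hmem S v hva).2 h)
    · intro S _
      simp

/-- The finite set of path covers of `D`. -/
noncomputable def allPathCovers (D : Digraph V) : Finset (Digraph V) :=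
  haveI : Finite (Digraph V) := Finite.of_injective _ adj_injective
  (Set.toFinite {E : Digraph V | D.IsPathCover E}).toFinset

theorem mem_allPathCovers {D E : Digraph V} : E ∈ D.allPathCovers ↔ E ≤ D ∧ E.IsPaths := by
  simp [allPathCovers, IsPathCover, IsPaths]

/-- A subdigraph of a permutation is determined by the set of vertices whose outgoing arrow it
omits. -/
theorem sum_allPathCovers_ofPerm {M : Type*} [AddCommMonoid M] (σ : Equiv.Perm V)
    (g : Digraph V → M) :
    ∑ E ∈ (ofPerm σ).allPathCovers, g E = ∑ S : Finset V with (cut σ S).IsPaths, g (cut σ S) := by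
  have hcut {E : Digraph V} (h : E ≤ ofPerm σ) :
      cut σ (Finset.univ.filter fun v => ¬ E.Adj v (σ v)) = E := by
    ext v w
    simp only [cut, Finset.mem_filter, Finset.mem_univ, true_and, not_not]
    constructor
    · rintro ⟨rfl, h⟩
      exact h
    · intro hvw
      have := adj_of_le_ofPerm h hvw
      exact ⟨this, this ▸ hvw⟩
  refine Finset.sum_bij' (fun E _ => Finset.univ.filter fun v => ¬ E.Adj v (σ v))
    (fun S _ => cut σ S) ?_ ?_ ?_ ?_ ?_
  · intro E hE
    rw [mem_allPathCovers] at hE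
    simpa [hcut hE.1] using hE.2
  · intro S hS
    exact mem_allPathCovers.2 ⟨cut_le σ S, by simpa using hS⟩
  · intro E hE
    exact hcut (mem_allPathCovers.1 hE).1
  · intro S _
    ext v
    simp [cut]
  · intro E hE
    rw [hcut (mem_allPathCovers.1 hE).1]

/-- Every path has exactly one end, and the ends are the elements of `S`. -/
theorem IsPaths.card_component_cut {σ : Equiv.Perm V} {S : Finset V}
    (h : (cut σ S).IsPaths) : Fintype.card (cut σ S).Component = S.card := by
  have hend (v : V) : (∀ u, ¬ (cut σ S).Adj v u) ↔ v ∈ S := by simp [cut]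
  rw [← Fintype.card_coe]
  refine (Fintype.card_of_bijective (f := fun v : S => (cut σ S).componentOf v) ⟨?_, ?_⟩).symm
  · intro v w hvw
    exact Subtype.ext (h.terminal_unique hvw ((hend v).2 v.2) ((hend w).2 w.2))
  · intro C
    obtain ⟨v, hv, hv'⟩ := h.exists_terminal C
    exact ⟨⟨v, (hend v).1 hv'⟩, hv⟩

theorem card_parts_type (E : Digraph V) : Multiset.card E.type.parts = Fintype.card E.Component := by
  simp [type]

/-- Collects the signs in front of each single colouring. -/
theorem sum_smul_sum_filter {ι κ M : Type*} [Fintype ι] [Fintype κ] [AddCommGroup M]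
    (P : ι → Prop) (R : ι → κ → Prop) (c : ι → ℤ) (w : κ → M) :
    ∑ i with P i, c i • ∑ k with R i k, w k = ∑ k, (∑ i with P i ∧ R i k, c i) • w k := by
  simp only [Finset.sum_filter, Finset.sum_smul, Finset.smul_sum]
  rw [Finset.sum_comm]
  refine Finset.sum_congr rfl fun i _ => ?_
  by_cases hi : P i
  · simp [hi]
  · simp [hi]

theorem powerPart_eq_sum_elemPart (σ : Equiv.Perm V) :
    SymmFun.powerPart (ofPerm σ).type = ∑ E ∈ (ofPerm σ).allPathCovers,
      (-1 : ℤ) ^ (Fintype.card V - Fintype.card E.Component) • SymmFun.elemPart E.type := by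
  refine SymmFun.eq_of_trunc_eq fun N => ?_
  have h : ∀ S ∈ Finset.univ.filter fun S : Finset V => (cut σ S).IsPaths,
      SymmFun.trunc N ((-1 : ℤ) ^ (Fintype.card V - Fintype.card (cut σ S).Component) •
        SymmFun.elemPart (cut σ S).type) = (-1 : ℤ) ^ (Fintype.card V - S.card) •
          ∑ κ : V → Fin N with Respects (cut σ S).Adj (· < ·) κ,
            ∏ v, MvPowerSeries.X (κ v) := by
    intro S hS
    have hS' := (Finset.mem_filter.1 hS).2
    rw [map_zsmul, trunc_elemPart_type hS', hS'.card_component_cut]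
  rw [trunc_powerPart_type, sum_allPathCovers_ofPerm, map_sum, Finset.sum_congr rfl h,
    sum_smul_sum_filter, Finset.sum_filter]
  refine Finset.sum_congr rfl fun κ _ => ?_
  rw [sum_isPaths_cut_respects_lt, ite_smul, one_smul, zero_smul]

theorem powerPart_eq_sum_homogPart (σ : Equiv.Perm V) :
    SymmFun.powerPart (ofPerm σ).type = ∑ E ∈ (ofPerm σ).allPathCovers,
      (-1 : ℤ) ^ (Fintype.card E.Component + Fintype.card (ofPerm σ).Component) •
        SymmFun.homogPart E.type := by
  refine SymmFun.eq_of_trunc_eq fun N => ?_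
  have h : ∀ S ∈ Finset.univ.filter fun S : Finset V => (cut σ S).IsPaths,
      SymmFun.trunc N ((-1 : ℤ) ^ (Fintype.card (cut σ S).Component +
        Fintype.card (ofPerm σ).Component) • SymmFun.homogPart (cut σ S).type) =
        (-1 : ℤ) ^ Fintype.card (ofPerm σ).Component • (-1 : ℤ) ^ S.card •
          ∑ κ : V → Fin N with Respects (cut σ S).Adj (· ≤ ·) κ,
            ∏ v, MvPowerSeries.X (κ v) := by
    intro S hS
    have hS' := (Finset.mem_filter.1 hS).2
    rw [map_zsmul, trunc_homogPart_type hS', hS'.card_component_cut, pow_add, mul_comm, mul_smul]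
  rw [trunc_powerPart_type, sum_allPathCovers_ofPerm, map_sum, Finset.sum_congr rfl h,
    ← Finset.smul_sum, sum_smul_sum_filter, Finset.sum_filter, Finset.smul_sum]
  refine Finset.sum_congr rfl fun κ _ => ?_
  rw [sum_isPaths_cut_respects_le, ite_smul, zero_smul, smul_ite, smul_smul, ← mul_pow]
  simp

end Digraph

/-! ### Orbit counts and the sign of a permutation -/

theorem Fintype.card_eq_of_surjective {V A B : Type*} [Fintype A] [Fintype B] {f : V → A}
    {g : V → B} (hf : Function.Surjective f) (hg : Function.Surjective g)
    (h : ∀ v w, f v = f w ↔ g v = g w) : Fintype.card A = Fintype.card B := by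
  refine Fintype.card_of_bijective (f := fun a => g (Function.surjInv hf a)) ⟨?_, fun b => ?_⟩
  · intro a b hab
    rw [← Function.surjInv_eq hf a, ← Function.surjInv_eq hf b]
    exact (h _ _).2 hab
  · obtain ⟨v, rfl⟩ := hg b
    exact ⟨f v, (h _ _).1 (Function.surjInv_eq hf _)⟩

namespace Digraph

variable {V : Type*} [Fintype V] [DecidableEq V]

/-- The orbits of a permutation are its fixed points and its nontrivial cycles. -/
theorem card_component_ofPerm (σ : Equiv.Perm V) :
    Fintype.card (ofPerm σ).Component + σ.support.card =
      Fintype.card V + σ.cycleFactorsFinset.card := by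
  have hne (c : σ.cycleFactorsFinset) : ∃ x, x ∈ (c : Equiv.Perm V).support :=
    (Equiv.Perm.mem_cycleFactorsFinset_iff.1 c.2).1.nonempty_support
  choose x hx using hne
  have hcyc (c : σ.cycleFactorsFinset) : (c : Equiv.Perm V) = σ.cycleOf (x c) :=
    Equiv.Perm.cycle_is_cycleOf (hx c) c.2
  have hmoved (c : σ.cycleFactorsFinset) : σ (x c) ≠ x c :=
    Equiv.Perm.mem_support.1 (Equiv.Perm.mem_cycleFactorsFinset_support_le c.2 (hx c))
  let f : (↥(σ.supportᶜ) ⊕ σ.cycleFactorsFinset) → (ofPerm σ).Component :=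
    Sum.elim (fun v => (ofPerm σ).componentOf v) fun c => (ofPerm σ).componentOf (x c)
  have hfix (v : ↥(σ.supportᶜ)) : σ v = v :=
    Equiv.Perm.notMem_support.1 (Finset.mem_compl.1 v.2)
  have hf : Function.Bijective f := by
    constructor
    · rintro (v | c) (w | d) h
      · have h' := componentOf_ofPerm_eq_iff.1 h
        rw [Subtype.ext (h'.eq_of_left (hfix v))]
      · have h' := componentOf_ofPerm_eq_iff.1 h
        exact absurd (h'.apply_eq_self_iff.1 (hfix v)) (hmoved d)
      · have h' := componentOf_ofPerm_eq_iff.1 h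
        exact absurd (h'.apply_eq_self_iff.2 (hfix w)) (hmoved c)
      · have h' := componentOf_ofPerm_eq_iff.1 h
        refine congrArg Sum.inr (Subtype.ext ?_)
        rw [hcyc c, hcyc d, h'.cycleOf_eq]
    · intro C
      obtain ⟨v, rfl⟩ := (ofPerm σ).componentOf_surjective C
      by_cases hv : v ∈ σ.support
      · refine ⟨Sum.inr ⟨σ.cycleOf v, Equiv.Perm.cycleOf_mem_cycleFactorsFinset_iff.2 hv⟩, ?_⟩
        have := hx ⟨σ.cycleOf v, Equiv.Perm.cycleOf_mem_cycleFactorsFinset_iff.2 hv⟩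
        exact (componentOf_ofPerm_eq_iff.2 (Equiv.Perm.mem_support_cycleOf_iff.1 this).1).symm
      · exact ⟨Sum.inl ⟨v, Finset.mem_compl.2 hv⟩, rfl⟩
  rw [← Fintype.card_of_bijective hf, Fintype.card_sum, Fintype.card_coe, Fintype.card_coe,
    Finset.card_compl]
  have := Finset.card_le_univ σ.support
  omega

/-- The sign of a permutation in terms of the number of its orbits. -/
theorem sign_eq_neg_one_pow_card_component (σ : Equiv.Perm V) :
    (Equiv.Perm.sign σ : ℤ) = (-1) ^ (Fintype.card V + Fintype.card (ofPerm σ).Component) := by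
  have h := card_component_ofPerm σ
  have hc : Multiset.card σ.cycleType = σ.cycleFactorsFinset.card := by
    simp [Equiv.Perm.cycleType_def]
  rw [Equiv.Perm.sign_of_cycleType, Equiv.Perm.sum_cycleType, hc]
  push_cast
  -- By `card_component_ofPerm` the two exponents have the same parity.
  rw [neg_one_pow_eq_pow_mod_two, neg_one_pow_eq_pow_mod_two (_ + Fintype.card _)]
  congr 1
  omega

end Digraph

/-! ### Contraction of the paths of a path cover -/

namespace Digraph

variable {V : Type*} {E : Digraph V}

namespace IsPaths

/-- The last vertex of a path. -/
noncomputable def terminal (hE : E.IsPaths) (C : E.Component) : V :=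
  (hE.exists_terminal C).choose

/-- The first vertex of a path. -/
noncomputable def initial (hE : E.IsPaths) (C : E.Component) : V :=
  (hE.exists_initial C).choose

theorem componentOf_terminal (hE : E.IsPaths) (C : E.Component) :
    E.componentOf (hE.terminal C) = C :=
  (hE.exists_terminal C).choose_spec.1

theorem not_adj_terminal (hE : E.IsPaths) (C : E.Component) (u : V) :
    ¬ E.Adj (hE.terminal C) u :=
  (hE.exists_terminal C).choose_spec.2 u

theorem componentOf_initial (hE : E.IsPaths) (C : E.Component) :
    E.componentOf (hE.initial C) = C :=
  (hE.exists_initial C).choose_spec.1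

theorem not_adj_initial (hE : E.IsPaths) (C : E.Component) (u : V) :
    ¬ E.Adj u (hE.initial C) :=
  (hE.exists_initial C).choose_spec.2 u

theorem eq_terminal (hE : E.IsPaths) {v : V} (hv : ∀ u, ¬ E.Adj v u) :
    v = hE.terminal (E.componentOf v) :=
  hE.terminal_unique (hE.componentOf_terminal _).symm hv (hE.not_adj_terminal _)

theorem eq_initial (hE : E.IsPaths) {v : V} (hv : ∀ u, ¬ E.Adj u v) :
    v = hE.initial (E.componentOf v) :=
  hE.initial_unique (hE.componentOf_initial _).symm hv (hE.not_adj_initial _)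

theorem contract_adj_iff (hE : E.IsPaths) {D : Digraph V} {P Q : E.Component} :
    (D.contract E).Adj P Q ↔ D.Adj (hE.terminal P) (hE.initial Q) := by
  constructor
  · rintro ⟨v, hv, w, hw, hv', hw', h⟩
    rw [mem_verts_iff] at hv hw
    rw [hE.eq_terminal hv', hE.eq_initial hw', hv, hw] at h
    exact h
  · intro h
    exact ⟨_, mem_verts_iff.2 (hE.componentOf_terminal P), _,
      mem_verts_iff.2 (hE.componentOf_initial Q), hE.not_adj_terminal P, hE.not_adj_initial Q, h⟩

/-- The image of the last vertex of a path under a permutation extending the paths is the first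
vertex of a path. -/
theorem apply_terminal (hE : E.IsPaths) {σ : Equiv.Perm V} (h : E ≤ ofPerm σ) (C : E.Component) :
    σ (hE.terminal C) = hE.initial (E.componentOf (σ (hE.terminal C))) := by
  refine hE.eq_initial fun u hu => ?_
  have := σ.injective (adj_of_le_ofPerm h hu)
  exact hE.not_adj_terminal C _ (this ▸ hu)

variable [Finite V]

/-- The permutation of the paths of `E` induced by a permutation of the vertices that extends
`E`. -/
noncomputable def contractPerm (hE : E.IsPaths) {σ : Equiv.Perm V} (h : E ≤ ofPerm σ) :
    Equiv.Perm E.Component :=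
  Equiv.ofBijective (fun C => E.componentOf (σ (hE.terminal C))) <| by
    refine Finite.injective_iff_bijective.1 fun P Q hPQ => ?_
    have h1 : σ (hE.terminal P) = σ (hE.terminal Q) := by
      rw [hE.apply_terminal h P, hE.apply_terminal h Q]
      exact congrArg hE.initial hPQ
    rw [← hE.componentOf_terminal P, σ.injective h1, hE.componentOf_terminal Q]

theorem contractPerm_apply (hE : E.IsPaths) {σ : Equiv.Perm V} (h : E ≤ ofPerm σ)
    (C : E.Component) : hE.contractPerm h C = E.componentOf (σ (hE.terminal C)) :=
  rfl

open Classical in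
/-- The permutation of the vertices induced by a permutation of the paths of `E`. -/
noncomputable def expandPerm (hE : E.IsPaths) (τ : Equiv.Perm E.Component) : Equiv.Perm V :=
  Equiv.ofBijective
    (fun v => if h : ∃ w, E.Adj v w then h.choose else hE.initial (τ (E.componentOf v))) <| by
    refine Finite.injective_iff_bijective.1 fun v w hvw => ?_
    split_ifs at hvw with hv hw hw
    · exact hE.left_unique hv.choose_spec (hvw ▸ hw.choose_spec)
    · exact absurd (hvw ▸ hv.choose_spec) (hE.not_adj_initial _ _)
    · exact absurd (hvw ▸ hw.choose_spec) (hE.not_adj_initial _ _)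
    · have h1 := congrArg E.componentOf hvw
      rw [hE.componentOf_initial, hE.componentOf_initial] at h1
      exact hE.terminal_unique (τ.injective h1) (not_exists.1 hv) (not_exists.1 hw)

theorem expandPerm_apply_of_adj (hE : E.IsPaths) (τ : Equiv.Perm E.Component) {v w : V}
    (h : E.Adj v w) : hE.expandPerm τ v = w := by
  have hex : ∃ w, E.Adj v w := ⟨w, h⟩
  simp only [expandPerm, Equiv.ofBijective_apply, dif_pos hex]
  exact hE.right_unique hex.choose_spec h

theorem le_ofPerm_expandPerm (hE : E.IsPaths) (τ : Equiv.Perm E.Component) :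
    E ≤ ofPerm (hE.expandPerm τ) :=
  fun _ _ h => hE.expandPerm_apply_of_adj τ h

theorem expandPerm_apply_terminal (hE : E.IsPaths) (τ : Equiv.Perm E.Component)
    (C : E.Component) : hE.expandPerm τ (hE.terminal C) = hE.initial (τ C) := by
  have hex : ¬ ∃ w, E.Adj (hE.terminal C) w := not_exists.2 (hE.not_adj_terminal C)
  simp only [expandPerm, Equiv.ofBijective_apply, dif_neg hex, hE.componentOf_terminal]

theorem contractPerm_expandPerm (hE : E.IsPaths) (τ : Equiv.Perm E.Component) :
    hE.contractPerm (hE.le_ofPerm_expandPerm τ) = τ := by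
  ext C
  rw [contractPerm_apply, expandPerm_apply_terminal, componentOf_initial]

theorem expandPerm_contractPerm (hE : E.IsPaths) {σ : Equiv.Perm V} (h : E ≤ ofPerm σ) :
    hE.expandPerm (hE.contractPerm h) = σ := by
  ext v
  by_cases hv : ∃ w, E.Adj v w
  · obtain ⟨w, hw⟩ := hv
    rw [hE.expandPerm_apply_of_adj _ hw, adj_of_le_ofPerm h hw]
  · rw [hE.eq_terminal (not_exists.1 hv), expandPerm_apply_terminal, contractPerm_apply,
      ← hE.apply_terminal h]

/-- Arrows of `σ` leaving a vertex that is not an end lie in `E ≤ D`; the remaining ones, from an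
end to a beginning, are the arrows tested in `D/E`. -/
theorem contractPerm_mem_perms_iff [Fintype V] (hE : E.IsPaths) {D : Digraph V} (hD : E ≤ D)
    {σ : Equiv.Perm V} (h : E ≤ ofPerm σ) :
    hE.contractPerm h ∈ (D.contract E).perms ↔ σ ∈ D.perms := by
  simp only [mem_perms, hE.contract_adj_iff, contractPerm_apply, ← hE.apply_terminal h]
  refine ⟨fun hτ v => ?_, fun hσ C => hσ _⟩
  by_cases hv : ∃ w, E.Adj v w
  · exact hD ((adj_apply_iff h).2 hv)
  · rw [hE.eq_terminal (not_exists.1 hv)]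
    exact hτ _

/-- One step of the contracted permutation is a walk along `σ` to the end of the path and one step
further, so it stays in the same cycle of `σ`. Conversely a step of `σ` either stays on its path or
is a step of the contracted permutation. -/
theorem sameCycle_contractPerm_iff (hE : E.IsPaths) {σ : Equiv.Perm V} (h : E ≤ ofPerm σ)
    {v w : V} : (hE.contractPerm h).SameCycle (E.componentOf v) (E.componentOf w) ↔
      σ.SameCycle v w := by
  constructor
  · intro hvw
    obtain ⟨i, hi⟩ := hvw.exists_nat_pow_eq
    clear hvw
    induction i generalizing v with
    | zero => exact sameCycle_of_componentOf_eq h hi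
    | succ i ih =>
      have h1 : σ.SameCycle v (hE.terminal (E.componentOf v)) :=
        sameCycle_of_componentOf_eq h (hE.componentOf_terminal _).symm
      rw [pow_succ, Equiv.Perm.mul_apply, contractPerm_apply] at hi
      exact h1.trans (Equiv.Perm.sameCycle_apply_left.1 (ih hi))
  · intro hvw
    rw [← componentOf_ofPerm_eq_iff] at hvw ⊢
    refine eq_of_componentOf_eq
      (g := fun v => (ofPerm (hE.contractPerm h)).componentOf (E.componentOf v)) ?_ hvw
    rintro a _ rfl
    by_cases ha : ∃ w, E.Adj a w
    · exact congrArg _ (componentOf_eq_of_adj ((adj_apply_iff h).2 ha))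
    · refine componentOf_eq_of_adj ?_
      change E.componentOf (σ (hE.terminal (E.componentOf a))) = _
      rw [← hE.eq_terminal (not_exists.1 ha)]

theorem card_component_contractPerm (hE : E.IsPaths) {σ : Equiv.Perm V} (h : E ≤ ofPerm σ) :
    Fintype.card (ofPerm (hE.contractPerm h)).Component = Fintype.card (ofPerm σ).Component := by
  refine Fintype.card_eq_of_surjective
    (f := fun v => (ofPerm (hE.contractPerm h)).componentOf (E.componentOf v))
    ((componentOf_surjective _).comp (componentOf_surjective _)) (componentOf_surjective _)
    fun v w => ?_
  rw [componentOf_ofPerm_eq_iff, componentOf_ofPerm_eq_iff, hE.sameCycle_contractPerm_iff h]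

end IsPaths

end Digraph

/-! ### Double counting and the two expansions -/

namespace Digraph

variable {V : Type*} [Fintype V]

theorem det_adjacencyMatrix [DecidableEq V] (D : Digraph V) :
    D.adjacencyMatrix.det = ∑ σ ∈ D.perms, (Equiv.Perm.sign σ : ℤ) := by
  classical
  -- The Leibniz formula in `Matrix.det_apply'` uses the entries `(σ i, i)`; transposing makes them
  -- arrows `i → σ i`.
  rw [← Matrix.det_transpose, Matrix.det_apply', perms, Finset.sum_filter]
  refine Finset.sum_congr (by ext; simp) fun σ _ => ?_
  simp only [Matrix.transpose_apply, adjacencyMatrix, Matrix.of_apply, Finset.prod_boole,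
    Finset.mem_univ, true_imp_iff, mul_ite, mul_one, mul_zero]
  split_ifs <;> rfl

open Classical in
theorem sum_perms_contract {M : Type*} [AddCommMonoid M] {D E : Digraph V} (hD : E ≤ D)
    (hE : E.IsPaths) (f : Equiv.Perm E.Component → M) (g : Equiv.Perm V → M)
    (hfg : ∀ (σ : Equiv.Perm V) (h : E ≤ ofPerm σ), f (hE.contractPerm h) = g σ) :
    ∑ τ ∈ (D.contract E).perms, f τ = ∑ σ ∈ D.perms with E ≤ ofPerm σ, g σ := by
  refine Finset.sum_bij' (fun τ _ => hE.expandPerm τ)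
    (fun σ hσ => hE.contractPerm (Finset.mem_filter.1 hσ).2) ?_ ?_ ?_ ?_ ?_
  · intro τ hτ
    have h := hE.le_ofPerm_expandPerm τ
    rw [Finset.mem_filter, ← hE.contractPerm_mem_perms_iff hD h, hE.contractPerm_expandPerm]
    exact ⟨hτ, h⟩
  · intro σ hσ
    exact (hE.contractPerm_mem_perms_iff hD _).2 (Finset.mem_filter.1 hσ).1
  · intro τ _
    exact hE.contractPerm_expandPerm τ
  · intro σ hσ
    exact hE.expandPerm_contractPerm _
  · intro τ _
    rw [← hfg _ (hE.le_ofPerm_expandPerm τ), hE.contractPerm_expandPerm]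

open Classical in
theorem card_cycleCovers_contract {D E : Digraph V} (hD : E ≤ D) (hE : E.IsPaths) :
    ((D.contract E).cycleCovers.card : ℤ) = ∑ σ ∈ D.perms with E ≤ ofPerm σ, (1 : ℤ) := by
  rw [cycleCovers_eq_map, Finset.card_map, ← sum_perms_contract hD hE (fun _ => 1) _
    fun _ _ => rfl]
  simp

open Classical in
theorem det_adjacencyMatrix_contract {D E : Digraph V} (hD : E ≤ D) (hE : E.IsPaths) :
    (D.contract E).adjacencyMatrix.det = ∑ σ ∈ D.perms with E ≤ ofPerm σ,
      (-1 : ℤ) ^ (Fintype.card E.Component + Fintype.card (ofPerm σ).Component) := by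
  rw [← sum_perms_contract hD hE (fun τ => (Equiv.Perm.sign τ : ℤ)) _ fun σ h => ?_]
  · convert det_adjacencyMatrix (D.contract E)
  · rw [← hE.card_component_contractPerm h]
    convert sign_eq_neg_one_pow_card_component (hE.contractPerm h)

theorem sum_allPathCovers {M : Type*} [AddCommMonoid M] (D : Digraph V) (g : Digraph V → M) :
    ∑ E ∈ D.allPathCovers, g E = ∑ μ, ∑ E ∈ D.pathCovers μ, g E := by
  classical
  rw [← Finset.sum_fiberwise D.allPathCovers type]
  refine Finset.sum_congr rfl fun μ _ => Finset.sum_congr ?_ fun _ _ => rfl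
  ext E
  simp [allPathCovers, pathCovers]

theorem mem_pathCovers {D E : Digraph V} {μ : (Fintype.card V).Partition} :
    E ∈ D.pathCovers μ ↔ (E ≤ D ∧ E.IsPaths) ∧ E.type = μ := by
  simp [pathCovers, IsPathCover, IsPaths]

open Classical in
-- Both sides range over pairs `E ≤ ofPerm σ`; then `E ≤ D` is automatic, since all arrows of `σ`
-- are in `D`.
theorem sum_perms_sum_allPathCovers {M : Type*} [AddCommMonoid M] (D : Digraph V)
    (g : Digraph V → Equiv.Perm V → M) :
    ∑ σ ∈ D.perms, ∑ E ∈ (ofPerm σ).allPathCovers, g E σ =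
      ∑ E ∈ D.allPathCovers, ∑ σ ∈ D.perms with E ≤ ofPerm σ, g E σ := by
  refine Finset.sum_comm' fun σ E => ?_
  simp only [mem_allPathCovers, Finset.mem_filter, mem_perms]
  refine ⟨fun h => ⟨⟨h.1, h.2.1⟩, ?_, h.2.2⟩, fun h => ⟨h.1.1, h.1.2, h.2.2⟩⟩
  intro v w hvw
  rw [← adj_of_le_ofPerm h.2.1 hvw]
  exact h.1 v

theorem cycleSymm_eq_sum_elemPart (D : Digraph V) :
    D.cycleSymm = ∑ μ,
      (((D.pathCovers μ).sigma fun E => (D.contract E).cycleCovers).card : ℤ) •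
        ((-1 : ℤ) ^ (Fintype.card V - Multiset.card μ.parts) • SymmFun.elemPart μ) := by
  classical
  simp only [cycleSymm_eq_sum, powerPart_eq_sum_elemPart]
  rw [sum_perms_sum_allPathCovers, sum_allPathCovers]
  refine Finset.sum_congr rfl fun μ _ => ?_
  rw [Finset.card_sigma, Nat.cast_sum, Finset.sum_smul]
  refine Finset.sum_congr rfl fun E hE => ?_
  obtain ⟨⟨hD, hP⟩, rfl⟩ := mem_pathCovers.1 hE
  rw [card_cycleCovers_contract hD hP, card_parts_type, Finset.sum_smul]
  simp only [one_smul]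

theorem cycleSymm_eq_sum_homogPart (D : Digraph V) :
    D.cycleSymm = ∑ μ, (∑ E ∈ D.pathCovers μ, (D.contract E).adjacencyMatrix.det) •
      SymmFun.homogPart μ := by
  classical
  simp only [cycleSymm_eq_sum, powerPart_eq_sum_homogPart]
  rw [sum_perms_sum_allPathCovers, sum_allPathCovers]
  refine Finset.sum_congr rfl fun μ _ => ?_
  rw [Finset.sum_smul]
  refine Finset.sum_congr rfl fun E hE => ?_
  obtain ⟨⟨hD, hP⟩, rfl⟩ := mem_pathCovers.1 hE
  rw [det_adjacencyMatrix_contract hD hP, Finset.sum_smul]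

end Digraph

theorem LinearIndependent.sum_smul_eq_sum_smul_iff {ι M : Type*} [Fintype ι] [AddCommGroup M]
    {v : ι → M} (hv : LinearIndependent ℤ v) {c d : ι → ℤ} :
    ∑ i, d i • v i = ∑ i, c i • v i ↔ ∀ i, c i = d i := by
  refine ⟨fun h i => ?_, fun h => by simp only [h]⟩
  rw [← sub_eq_zero, ← Finset.sum_sub_distrib] at h
  simp only [← sub_smul] at h
  exact (sub_eq_zero.1 (Fintype.linearIndependent_iff.1 hv _ h i)).symm

theorem mainTheorem3 {V : Type*} [Fintype V] (D : Digraph V) :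
    (∀ c : (Fintype.card V).Partition → ℤ,
      D.cycleSymm = ∑ μ, c μ •
          ((-1 : ℤ) ^ (Fintype.card V - Multiset.card μ.parts) • SymmFun.elemPart μ) ↔
        ∀ μ, c μ = (((D.pathCovers μ).sigma fun E => (D.contract E).cycleCovers).card : ℤ)) ∧
    (∀ c : (Fintype.card V).Partition → ℤ,
      D.cycleSymm = ∑ μ, c μ • SymmFun.homogPart μ ↔
        ∀ μ, c μ = ∑ E ∈ D.pathCovers μ, (D.contract E).adjacencyMatrix.det) := by
  constructor
  · intro c
    rw [D.cycleSymm_eq_sum_elemPart]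
    simp only [smul_smul]
    rw [(SymmFun.linearIndependent_elemPart _).sum_smul_eq_sum_smul_iff]
    -- The signs are nonzero integers, so they cancel from the two coefficients.
    exact forall_congr' fun μ => mul_left_inj' (pow_ne_zero _ (by norm_num))
  · intro c
    rw [D.cycleSymm_eq_sum_homogPart]
    exact (SymmFun.linearIndependent_homogPart _).sum_smul_eq_sum_smul_iff
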